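/- For $\alpha\in\mathbb{R}$ let $D_\alpha$ be the space of analytic functions $f(z)=\sum_{n\ge 0}a_nz^n$ in the unit disc $\mathbb{D}$ with $\|f\|_\alpha^2:=\sum_{n\ge 0}|a_n|^2(n+1)^\alpha<\infty$, a Hilbert space with inner product $\langle f,g\rangle_\alpha=\sum_{n\ge0} a_n\overline{b_n}(n+1)^\alpha$, where $g(z)=\sum_{n\ge0} b_nz^n$. If $B$ is an analytic function in $\mathbb{D}$ with $BD_\alpha\subseteq D_\alpha$, let $M_B:f\mapsto Bf$ be the multiplication operator on $D_\alpha$ and let $\mathrm{Lat}(M_B)$ be the set of all closed subspaces $M\subseteq D_\alpha$ with $BM\subseteq M$. For a subspace $K\subseteq D_\alpha$ let $[K]_B$ be the smallest element of $\mathrm{Lat}(M_B)$ that contains $K$. Given an inner product on $D_\alpha$ whose norm $\|\cdot\|$ is equivalent to $\|\cdot\|_\alpha$, let $M\ominus BM$ be the set of all $f\in M$ that are orthogonal to $BM$ for this inner product; we say that $M_B$ has the wandering subspace property with respect to $\|\cdot\|$ if $[M\ominus BM]_B=M$ for every $M\in\mathrm{Lat}(M_B)$. Theorem. (1) Let $\alpha\in[-1,1]$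 and let $$B(z)=e^{i\theta}\prod_{i=1}^N\frac{z-a_i}{1-\overline{a_i}z}\qquad(\theta\in\mathbb{R},\ N\ge 1,\ a_1,\dots,a_N\in\mathbb{D})$$ be a non-constant finite Blaschke product. Then $BD_\alpha\subseteq D_\alpha$, and there is an inner product on $D_\alpha$ whose norm $\|\cdot\|_B$ is equivalent to $\|\cdot\|_\alpha$ and with respect to which $M_B$ has the wandering subspace property. (2) If $B(z)=z^k$ with $k\ge 1$ an integer and $|\alpha|\le\frac{\log 2}{\log(k+1)}$, then $BD_\alpha\subseteq D_\alpha$ and one can take $\|\cdot\|_B=\|\cdot\|_\alpha$: $M_{z^k}$ has the wandering subspace property with respect to the usual norm of $D_\alpha$. -/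

import Mathlib

open scoped ComplexConjugate Complex.UnitDisc

noncomputable section

namespace DirichletWandering

/-! ### Dirichlet-type spaces on the unit disc -/

/-- The extension by zero to `ℂ` of a function on the open unit disc. -/
def extend (f : 𝔻 → ℂ) (z : ℂ) : ℂ :=
  open Classical in if h : ‖z‖ < 1 then f (Complex.UnitDisc.mk z h) else 0

/-- The function `f` is analytic in the open unit disc. -/
def IsAnalytic (f : 𝔻 → ℂ) : Prop :=
  DifferentiableOn ℂ (extend f) (Metric.ball 0 1)

/-- The `n`-th Taylor coefficient at the origin, `a_n = f⁽ⁿ⁾(0) / n!`. -/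
def taylorCoeff (f : 𝔻 → ℂ) (n : ℕ) : ℂ :=
  ((Nat.factorial n : ℕ) : ℂ)⁻¹ * iteratedDeriv n (extend f) 0

/-- The weight `(n + 1) ^ α`. -/
def weight (α : ℝ) (n : ℕ) : ℝ := ((n : ℝ) + 1) ^ α

theorem weight_pos (α : ℝ) (n : ℕ) : 0 < weight α n :=
  Real.rpow_pos_of_pos (by positivity) α

theorem extend_coe (f : 𝔻 → ℂ) (z : 𝔻) : extend f (z : ℂ) = f z := by
  have h : ‖(z : ℂ)‖ < 1 := z.norm_lt_one
  simp only [extend, h, dite_true]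
  rfl

theorem extend_zero : extend (0 : 𝔻 → ℂ) = 0 := by
  funext z; simp [extend]

theorem extend_add (f g : 𝔻 → ℂ) : extend (f + g) = extend f + extend g := by
  funext z
  by_cases h : ‖z‖ < 1 <;> simp [extend, h]

theorem extend_smul (c : ℂ) (f : 𝔻 → ℂ) : extend (c • f) = c • extend f := by
  funext z
  by_cases h : ‖z‖ < 1 <;> simp [extend, h]

theorem IsAnalytic.contDiffAt {f : 𝔻 → ℂ} (hf : IsAnalytic f) (n : ℕ) :
    ContDiffAt ℂ n (extend f) 0 :=
  (hf.analyticAt (Metric.isOpen_ball.mem_nhds (Metric.mem_ball_self one_pos))).contDiffAt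

theorem taylorCoeff_zero (n : ℕ) : taylorCoeff 0 n = 0 := by
  have h : extend (0 : 𝔻 → ℂ) = (0 : ℂ) • (0 : ℂ → ℂ) := by rw [extend_zero, zero_smul]
  rw [taylorCoeff, h, iteratedDeriv_const_smul_field, zero_smul, mul_zero]

theorem taylorCoeff_add {f g : 𝔻 → ℂ} (hf : IsAnalytic f) (hg : IsAnalytic g) (n : ℕ) :
    taylorCoeff (f + g) n = taylorCoeff f n + taylorCoeff g n := by
  simp only [taylorCoeff, extend_add]
  rw [iteratedDeriv_add (hf.contDiffAt n) (hg.contDiffAt n), mul_add]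

theorem taylorCoeff_smul (c : ℂ) (f : 𝔻 → ℂ) (n : ℕ) :
    taylorCoeff (c • f) n = c * taylorCoeff f n := by
  simp only [taylorCoeff, extend_smul]
  rw [iteratedDeriv_const_smul_field, smul_eq_mul]
  ring

/-- An analytic function on the disc is the sum of its Taylor series. -/
theorem IsAnalytic.hasSum {f : 𝔻 → ℂ} (hf : IsAnalytic f) (z : 𝔻) :
    HasSum (fun n : ℕ => taylorCoeff f n * (z : ℂ) ^ n) (f z) := by
  have h := Complex.hasSum_taylorSeries_on_ball (c := 0) (r := 1) (f := extend f)
    (by simpa [IsAnalytic] using hf) (z := (z : ℂ)) (by simpa using z.norm_lt_one)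
  rw [extend_coe] at h
  refine h.congr_fun ?_
  intro n
  simp only [taylorCoeff, smul_eq_mul, sub_zero]
  ring

/-- The Dirichlet-type space `D_α`: the analytic functions `f(z) = ∑ a_n z ^ n` in the unit disc
with `∑ |a_n|² (n + 1) ^ α < ∞`. -/
def D (α : ℝ) : Submodule ℂ (𝔻 → ℂ) where
  carrier := {f | IsAnalytic f ∧ Summable fun n => ‖taylorCoeff f n‖ ^ 2 * weight α n}
  zero_mem' := by
    refine ⟨?_, ?_⟩
    · rw [IsAnalytic, extend_zero]; exact differentiableOn_const 0
    · simp [taylorCoeff_zero, summable_zero]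
  add_mem' := by
    rintro f g ⟨hf, hf'⟩ ⟨hg, hg'⟩
    refine ⟨?_, ?_⟩
    · rw [IsAnalytic, extend_add]; exact DifferentiableOn.add hf hg
    · refine Summable.of_nonneg_of_le (fun n => ?_) (fun n => ?_) ((hf'.add hg').mul_left 2)
      · exact mul_nonneg (by positivity) (weight_pos α n).le
      · rw [taylorCoeff_add hf hg, ← add_mul, ← mul_assoc]
        refine mul_le_mul_of_nonneg_right ?_ (weight_pos α n).le
        have h1 := norm_add_le (taylorCoeff f n) (taylorCoeff g n)
        have h2 := norm_nonneg (taylorCoeff f n + taylorCoeff g n)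
        nlinarith [sq_nonneg (‖taylorCoeff f n‖ - ‖taylorCoeff g n‖)]
  smul_mem' := by
    rintro c f ⟨hf, hf'⟩
    refine ⟨?_, ?_⟩
    · rw [IsAnalytic, extend_smul]; exact DifferentiableOn.const_smul hf c
    · refine (hf'.mul_left (‖c‖ ^ 2)).congr fun n => ?_
      rw [taylorCoeff_smul, norm_mul]
      ring

theorem summable_inner {α : ℝ} (f g : D α) :
    Summable fun n => conj (taylorCoeff f n) * taylorCoeff g n * (weight α n : ℂ) := by
  refine Summable.of_norm_bounded (f.2.2.add g.2.2) fun n => ?_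
  rw [norm_mul, norm_mul, RCLike.norm_conj, Complex.norm_real, Real.norm_eq_abs,
    abs_of_pos (weight_pos α n), ← add_mul]
  refine mul_le_mul_of_nonneg_right ?_ (weight_pos α n).le
  nlinarith [sq_nonneg (‖taylorCoeff f n‖ - ‖taylorCoeff g n‖),
    mul_nonneg (norm_nonneg (taylorCoeff f n)) (norm_nonneg (taylorCoeff g n))]

theorem inner_self_eq {α : ℝ} (f : D α) :
    ∑' n, conj (taylorCoeff f n) * taylorCoeff f n * (weight α n : ℂ)
      = ((∑' n, ‖taylorCoeff f n‖ ^ 2 * weight α n : ℝ) : ℂ) := by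
  rw [Complex.ofReal_tsum]
  refine tsum_congr fun n => ?_
  rw [Complex.conj_mul']
  push_cast
  ring

/-- The usual inner product `⟪f, g⟫ = ∑ conj (a_n(f)) a_n(g) (n + 1) ^ α` of `D_α`
(linear in the second variable, as always in Mathlib). -/
@[reducible]
def usualInner (α : ℝ) : InnerProductSpace.Core ℂ (D α) where
  inner f g := ∑' n, conj (taylorCoeff f n) * taylorCoeff g n * (weight α n : ℂ)
  conj_inner_symm f g := by
    rw [Complex.conj_tsum]
    refine tsum_congr fun n => ?_
    simp only [map_mul, Complex.conj_conj, Complex.conj_ofReal]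
    ring
  re_inner_nonneg f := by
    rw [inner_self_eq]
    exact tsum_nonneg fun n => mul_nonneg (by positivity) (weight_pos α n).le
  add_left f g h := by
    rw [← (summable_inner f h).tsum_add (summable_inner g h)]
    refine tsum_congr fun n => ?_
    rw [Submodule.coe_add, taylorCoeff_add f.2.1 g.2.1, map_add]
    ring
  smul_left f g c := by
    rw [← tsum_mul_left]
    refine tsum_congr fun n => ?_
    rw [Submodule.coe_smul, taylorCoeff_smul, map_mul]
    ring
  definite f hf := by
    rw [inner_self_eq, Complex.ofReal_eq_zero] at hf
    have h0 : ∀ n, taylorCoeff f n = 0 := by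
      intro n
      have h := (hasSum_zero_iff_of_nonneg
        (fun n => mul_nonneg (by positivity) (weight_pos α n).le)).1 (hf ▸ f.2.2.hasSum)
      have hn := congrFun h n
      simpa [(weight_pos α n).ne'] using hn
    ext z
    have h := f.2.1.hasSum z
    simp only [h0, zero_mul] at h
    exact h.unique hasSum_zero

/-! ### Multipliers and finite Blaschke products -/

/-- `u` is a multiplier of `D_α`: multiplication by `u` is defined everywhere on `D_α`. -/
def IsMultiplier (α : ℝ) (u : 𝔻 → ℂ) : Prop :=
  ∀ f ∈ D α, u * f ∈ D α

/-- The multiplication operator `M_u : f ↦ u f` on `D_α` induced by a multiplier `u`. -/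
def mulOp {α : ℝ} {u : 𝔻 → ℂ} (hu : IsMultiplier α u) : D α →ₗ[ℂ] D α where
  toFun f := ⟨u * f, hu f f.2⟩
  map_add' f g := Subtype.ext (mul_add u (f : 𝔻 → ℂ) g)
  map_smul' c f := Subtype.ext (mul_smul_comm c u (f : 𝔻 → ℂ))

/-- The finite Blaschke product `e^{iθ} ∏ (z - a_i) / (1 - conj a_i z)` of degree `N`
with zeros `a_i` in the disc, repeated according to multiplicity. -/
def blaschke {N : ℕ} (θ : ℝ) (a : Fin N → 𝔻) (z : 𝔻) : ℂ :=
  Complex.exp (θ * Complex.I) *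
    ∏ i, ((z : ℂ) - (a i : ℂ)) / (1 - conj (a i : ℂ) * (z : ℂ))

/-- The monomial `z ^ k` on the disc. -/
def monomial (k : ℕ) (z : 𝔻) : ℂ := (z : ℂ) ^ k

/-! ### The wandering subspace property -/

section Wandering

variable {H : Type*} [NormedAddCommGroup H] [InnerProductSpace ℂ H]

/-- `Lat(T)`: the closed subspaces invariant under `T`. -/
def Lat (T : H →ₗ[ℂ] H) : Set (Submodule ℂ H) :=
  {M | IsClosed (M : Set H) ∧ ∀ x ∈ M, T x ∈ M}

/-- `[K]_T`: the smallest closed subspace that is invariant under `T` and contains `K`. -/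
def generated (T : H →ₗ[ℂ] H) (K : Submodule ℂ H) : Submodule ℂ H :=
  sInf {M | M ∈ Lat T ∧ K ≤ M}

/-- `M ⊖ T M`: the vectors of `M` that are orthogonal to `T M`. -/
def wandering (T : H →ₗ[ℂ] H) (M : Submodule ℂ H) : Submodule ℂ H :=
  M ⊓ (M.map T)ᗮ

/-- The wandering subspace property of `T`: `[M ⊖ T M]_T = M` for every `M ∈ Lat(T)`. -/
def HasWSP (T : H →ₗ[ℂ] H) : Prop :=
  ∀ M ∈ Lat T, generated T (wandering T M) = M

end Wandering

section Renorming

variable {E : Type*} [AddCommGroup E] [Module ℂ E]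

/-- The wandering subspace property of `T` with respect to the inner product `c` and the norm that
it defines (closures and orthogonality are taken with respect to `c`). -/
def HasWSPFor (c : InnerProductSpace.Core ℂ E) (T : E →ₗ[ℂ] E) : Prop :=
  letI : NormedAddCommGroup E := c.toNormedAddCommGroup
  letI : InnerProductSpace ℂ E := InnerProductSpace.ofCore c.toCore
  HasWSP T

/-- The norm `‖x‖ = √⟪x, x⟫` defined by the inner product `c`. -/
def normOf (c : InnerProductSpace.Core ℂ E) (x : E) : ℝ :=
  √(c.inner x x).re

/-- The norms defined by two inner products are equivalent. -/
def EquivalentNorms (c d : InnerProductSpace.Core ℂ E) : Prop :=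
  ∃ A B : ℝ, 0 < A ∧ 0 < B ∧ ∀ x, A * normOf c x ≤ normOf d x ∧ normOf d x ≤ B * normOf c x

end Renorming

/-- The norm of `usualInner α` is the usual norm `(∑ |a_n|² (n + 1) ^ α) ^ (1 / 2)` of `D_α`. -/
theorem normOf_usualInner {α : ℝ} (f : D α) :
    normOf (usualInner α) f = √(∑' n, ‖taylorCoeff f n‖ ^ 2 * weight α n) :=
  congrArg (fun z : ℂ => √z.re) (inner_self_eq f)

end DirichletWandering

end

/-! Two abstract theorems, in the spirit of Richter and Shimorin, carry both claims. If `⋂ TⁿH = 0`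
and `T` is either expanding with `‖T²x‖² + ‖x‖² ≤ 2‖Tx‖²`, or a contraction with `‖Tx + y‖² ≤ 2(‖x‖²
+ ‖Ty‖²)`, then `H ⊖ TH` generates `H` (`eq_top_of_concave`, `eq_top_of_contraction`). The
hypotheses are inherited by closed invariant subspaces, which gives the whole wandering subspace
property.

For an operator that shifts coefficients by `N` places, up to a unimodular factor, in a norm with
weights `(m + c) ^ α`, these hypotheses become inequalities between weights: concavity of `t ^ α` if
`0 ≤ α ≤ 1`; concavity of the inverse weight `t ^ (-α)`, together with `((N + c) / c) ^ (-α) ≤ 2`,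
if `-1 ≤ α < 0` (`hasWSP_of_shift`).

Multiplication by `z ^ k` is such a shift on Taylor coefficients, with `N = k` and `c = 1`. The
extra condition is then `(k + 1) ^ (-α) ≤ 2`, the source of the bound on `|α|`.

For a Blaschke product of degree `N`, repeat the zeros periodically and take the Takenaka–Malmquist
functions, an orthonormal basis of `H²`. By periodicity, multiplication by the product sends the
function of index `m` to a unimodular multiple of the one of index `m + N`, so it is again a shift
by `N`. With weights `(m + N) ^ α`, that is `c = N`, the extra condition reads `2 ^ (-α) ≤ 2` and
always holds.

It remains to compare this norm with the usual one. The change of basis is a unitary of `ℓ²` whose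
entries are exponentially small far from the diagonal, on both sides (`exists_coeff_takenaka_le`,
`exists_coeff_takenaka_le'`). Such a unitary is bounded for the weights `(n + 1) ^ α`: by summation
by parts over tails if `α ≥ 0`, by duality if `α < 0` (`exists_weightBounded`). -/

open scoped ComplexConjugate Complex.UnitDisc

namespace DirichletWandering

/-! ### Abstract wandering subspace theorems in Hilbert space. -/

section HilbertSpace

variable {H : Type*} [NormedAddCommGroup H] [InnerProductSpace ℂ H]

/-- To check the wandering subspace property at `M` it is enough to look at the restriction of the
operator to `M`. -/
theorem generated_wandering_eq {T : H →ₗ[ℂ] H} {M : Submodule ℂ H} (hM : M ∈ Lat T)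
    (h : ∀ G : Submodule ℂ M, IsClosed (G : Set M) → (∀ x ∈ G, T.restrict hM.2 x ∈ G) →
      (LinearMap.range (T.restrict hM.2))ᗮ ≤ G → G = ⊤) :
    generated T (wandering T M) = M := by
  refine le_antisymm (sInf_le ⟨hM, inf_le_left⟩) (le_sInf ?_)
  rintro G ⟨⟨hGc, hGi⟩, hG⟩
  have hT : G.comap M.subtype = ⊤ := by
    refine h _ (hGc.preimage continuous_subtype_val) (fun x hx => hGi _ hx) fun y hy => ?_
    refine hG ⟨y.2, ?_⟩
    rw [SetLike.mem_coe, Submodule.mem_orthogonal]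
    rintro _ ⟨x, hx, rfl⟩
    exact (Submodule.mem_orthogonal _ _).1 hy _ ⟨⟨x, hx⟩, rfl⟩
  intro x hx
  have : (⟨x, hx⟩ : M) ∈ G.comap M.subtype := hT ▸ Submodule.mem_top
  exact this

theorem clm_pow_succ_apply (T : H →L[ℂ] H) (n : ℕ) (x : H) : (T ^ (n + 1)) x = (T ^ n) (T x) := by
  rw [pow_succ]; rfl

theorem clm_pow_succ_apply' (T : H →L[ℂ] H) (n : ℕ) (x : H) :
    (T ^ (n + 1)) x = T ((T ^ n) x) := by
  rw [pow_succ']; rfl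

theorem norm_le_pow_mul (T : H →L[ℂ] H) {c : ℝ} (hc : 0 ≤ c) (h : ∀ x, ‖x‖ ≤ c * ‖T x‖) (n : ℕ)
    (x : H) : ‖x‖ ≤ c ^ n * ‖(T ^ n) x‖ := by
  induction n with
  | zero => simp
  | succ n ih =>
    rw [clm_pow_succ_apply']
    calc ‖x‖ ≤ c ^ n * ‖(T ^ n) x‖ := ih
      _ ≤ c ^ n * (c * ‖T ((T ^ n) x)‖) := by gcongr; exact h _
      _ = _ := by ring

/-- The sequence `‖Tⁿx‖²` is concave in `n`, hence lies below the line through its first two terms.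
-/
theorem concave_norm_sq_le {T : H →L[ℂ] H} (hconc : ∀ x, ‖T (T x)‖ ^ 2 + ‖x‖ ^ 2 ≤ 2 * ‖T x‖ ^ 2)
    (x : H) (n : ℕ) : ‖(T ^ n) x‖ ^ 2 ≤ ‖x‖ ^ 2 + n * (‖T x‖ ^ 2 - ‖x‖ ^ 2) := by
  have hstep : ∀ n : ℕ, ‖(T ^ (n + 1)) x‖ ^ 2 - ‖(T ^ n) x‖ ^ 2 ≤ ‖T x‖ ^ 2 - ‖x‖ ^ 2 := by
    intro n
    induction n with
    | zero => simp
    | succ n ih =>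
      have := hconc ((T ^ n) x)
      rw [clm_pow_succ_apply' T (n + 1), clm_pow_succ_apply' T n]
      rw [clm_pow_succ_apply'] at ih
      linarith
  induction n with
  | zero => simp
  | succ n ih =>
    rw [Nat.cast_succ]
    linarith [hstep n]

variable [CompleteSpace H]

/-- A bounded linear map that is bounded below has closed range. -/
theorem isClosed_range_of_le (T : H →L[ℂ] H) {c : ℝ} (hc : 0 ≤ c) (h : ∀ x, ‖x‖ ≤ c * ‖T x‖) :
    IsClosed (LinearMap.range (T : H →ₗ[ℂ] H) : Set H) := by
  have := (T.antilipschitz_of_bound (K := ⟨c, hc⟩) h).isClosed_range T.uniformContinuous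
  rwa [LinearMap.coe_range]

/-- If `T` is bounded below and `⋂ T ^ n H = 0` then a sequence in `T ^ n H` that is bounded along
infinitely many indices is weakly null along them. -/
theorem eq_zero_of_frequently_bounded (T : H →L[ℂ] H) {c : ℝ} (hc : 0 ≤ c)
    (h : ∀ x, ‖x‖ ≤ c * ‖T x‖) (hT : ∀ x, (∀ n, ∃ y, (T ^ n) y = x) → x = 0) {y : ℕ → H} {C : ℝ}
    (hy : ∃ᶠ n in Filter.atTop, ‖(T ^ n) (y n)‖ ≤ C) {v : H} {a : ℂ}
    (ha : ∀ n, inner ℂ v ((T ^ n) (y n)) = a) : a = 0 := by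
  -- The spaces `(TⁿH)ᗮ` increase, and their union is dense: a vector orthogonal to all of them lies
  -- in every `TⁿH`, because these ranges are closed.
  let R : ℕ → Submodule ℂ H := fun n => (LinearMap.range ((T ^ n : H →L[ℂ] H) : H →ₗ[ℂ] H))ᗮ
  have hR : Monotone R := by
    refine monotone_nat_of_le_succ fun n => Submodule.orthogonal_le ?_
    rintro _ ⟨x, rfl⟩
    exact ⟨T x, (clm_pow_succ_apply T n x).symm⟩
  have hdense : (⨆ n, R n).topologicalClosure = ⊤ := by
    rw [Submodule.topologicalClosure_eq_top_iff, eq_bot_iff]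
    intro x hx
    refine (Submodule.mem_bot ℂ).2 (hT x fun n => ?_)
    have h1 : x ∈ (R n)ᗮ := Submodule.orthogonal_le (le_iSup R n) hx
    have hcl := isClosed_range_of_le (T ^ n) (pow_nonneg hc n) (norm_le_pow_mul T hc h n)
    rw [Submodule.orthogonal_orthogonal_eq_closure, hcl.submodule_topologicalClosure_eq] at h1
    exact h1
  have hC : 0 ≤ C := by
    obtain ⟨n, hn⟩ := hy.exists
    exact (norm_nonneg _).trans hn
  by_contra hne
  have hpos : 0 < ‖a‖ := norm_pos_iff.2 hne
  have hv : v ∈ closure ((⨆ n, R n : Submodule ℂ H) : Set H) := by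
    rw [← Submodule.topologicalClosure_coe, hdense]; trivial
  -- With `u ∈ (TᵐH)ᗮ` this close to `v`, an index `n ≥ m` at which the sequence is bounded gives
  -- `‖a‖ ≤ ‖v - u‖ * C < ‖a‖`.
  obtain ⟨u, hu, huv⟩ := Metric.mem_closure_iff.1 hv (‖a‖ / (C + 1)) (by positivity)
  obtain ⟨m, hm⟩ := (Submodule.mem_iSup_of_directed R hR.directed_le).1 hu
  obtain ⟨n, hn, hnC⟩ := (Filter.frequently_atTop.1 hy) m
  have h0 : inner ℂ u ((T ^ n) (y n)) = 0 := by
    have := (Submodule.mem_orthogonal _ _).1 (hR hn hm) ((T ^ n) (y n)) ⟨y n, rfl⟩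
    exact inner_eq_zero_symm.1 this
  have h1 : a = inner ℂ (v - u) ((T ^ n) (y n)) := by rw [inner_sub_left, h0, ha n, sub_zero]
  have h2 : ‖a‖ ≤ ‖v - u‖ * C := by
    rw [h1]
    exact (norm_inner_le_norm _ _).trans (by gcongr)
  rw [dist_eq_norm, lt_div_iff₀ (by positivity)] at huv
  nlinarith [norm_nonneg (v - u)]

/-- For a concave expanding operator with `⋂ T ^ n H = 0`, the space is generated by `H ⊖ T H`. -/
theorem eq_top_of_concave (T : H →L[ℂ] H) (hexp : ∀ x, ‖x‖ ≤ ‖T x‖)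
    (hconc : ∀ x, ‖T (T x)‖ ^ 2 + ‖x‖ ^ 2 ≤ 2 * ‖T x‖ ^ 2)
    (hT : ∀ x, (∀ n, ∃ y, (T ^ n) y = x) → x = 0)
    (G : Submodule ℂ H) (hGc : IsClosed (G : Set H)) (hGi : ∀ x ∈ G, T x ∈ G)
    (hG : (LinearMap.range (T : H →ₗ[ℂ] H))ᗮ ≤ G) : G = ⊤ := by
  have hcl := isClosed_range_of_le T zero_le_one (fun x => by simpa using hexp x)
  have : CompleteSpace (LinearMap.range (T : H →ₗ[ℂ] H)) := hcl.completeSpace_coe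
  -- `T y` is the orthogonal projection of `x` onto the range of `T`, so `y` is the image of `x`
  -- under a left inverse of `T`.
  have hL : ∀ x : H, ∃ y : H, x - T y ∈ G ∧ ‖T y‖ ≤ ‖x‖ := by
    intro x
    obtain ⟨y, hy⟩ := (LinearMap.range (T : H →ₗ[ℂ] H)).starProjection_apply_mem x
    have hy' : T y = (LinearMap.range (T : H →ₗ[ℂ] H)).starProjection x := hy
    refine ⟨y, hG ?_, ?_⟩
    · rw [hy']; exact Submodule.sub_starProjection_mem_orthogonal x
    · rw [hy']; exact Submodule.norm_starProjection_apply_le _ x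
  choose L hL1 hL2 using hL
  have hGn : ∀ n : ℕ, ∀ x ∈ G, (T ^ n) x ∈ G := by
    intro n
    induction n with
    | zero => intro x hx; simpa using hx
    | succ n ih =>
      intro x hx
      rw [clm_pow_succ_apply]
      exact ih _ (hGi x hx)
  refine eq_top_iff.2 fun x _ => ?_
  let z : ℕ → H := fun n => L^[n] x
  have hz : ∀ n, z (n + 1) = L (z n) := fun n => Function.iterate_succ_apply' L n x
  have hmem : ∀ n, x - (T ^ n) (z n) ∈ G := by
    intro n
    induction n with
    | zero => simp [z]
    | succ n ih =>
      have h1 := hGn n _ (hL1 (z n))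
      have h2 := G.add_mem ih h1
      rw [map_sub, sub_add_sub_cancel] at h2
      rwa [clm_pow_succ_apply, hz]
  have hanti : ∀ n, ‖T (z (n + 1))‖ ≤ ‖z n‖ := fun n => by rw [hz]; exact hL2 _
  have hle : ∀ n, ‖z n‖ ≤ ‖x‖ := by
    intro n
    induction n with
    | zero => exact le_rfl
    | succ n ih => exact (hexp _).trans ((hanti n).trans ih)
  -- The series of `b` is dominated by the telescoping series of `‖z n‖² - ‖z (n + 1)‖²`.
  let b : ℕ → ℝ := fun n => ‖T (z (n + 1))‖ ^ 2 - ‖z (n + 1)‖ ^ 2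
  have hb0 : ∀ n, 0 ≤ b n := fun n =>
    sub_nonneg.2 (pow_le_pow_left₀ (norm_nonneg _) (hexp _) 2)
  have hbs : Summable b := by
    refine summable_of_sum_range_le (c := ‖x‖ ^ 2) hb0 fun n => ?_
    have : ∑ i ∈ Finset.range n, b i ≤ ‖z 0‖ ^ 2 - ‖z n‖ ^ 2 := by
      induction n with
      | zero => simp
      | succ n ih =>
        rw [Finset.sum_range_succ]
        have := pow_le_pow_left₀ (norm_nonneg _) (hanti n) 2
        simp only [b] at ih ⊢
        linarith
    have h0 : z 0 = x := rfl
    rw [h0] at this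
    nlinarith [norm_nonneg (z n)]
  have hfreq : ∃ᶠ n in Filter.atTop, ‖(T ^ n) (z n)‖ ≤ ‖x‖ + 1 := by
    have h1 : ∃ᶠ n : ℕ in Filter.atTop, ((n : ℝ) + 1) * b n ≤ 1 := by
      -- Otherwise `b n > 1 / (n + 1)` eventually, and the harmonic series would converge.
      intro hcon
      have hs : Summable fun n : ℕ => 1 / ((n : ℝ) + 1) := by
        refine Summable.of_norm_bounded_eventually_nat hbs (hcon.mono fun n hn => ?_)
        rw [Real.norm_eq_abs, abs_of_pos (by positivity), div_le_iff₀ (by positivity), mul_comm]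
        exact (not_le.1 hn).le
      exact Real.not_summable_one_div_natCast
        ((summable_nat_add_iff 1).1 (by simpa using hs))
    have h2 : ∃ᶠ n : ℕ in Filter.atTop, ‖(T ^ (n + 1)) (z (n + 1))‖ ≤ ‖x‖ + 1 := by
      refine h1.mono fun n hn => ?_
      have h3 := concave_norm_sq_le hconc (z (n + 1)) (n + 1)
      have h4 := pow_le_pow_left₀ (norm_nonneg _) (hle (n + 1)) 2
      rw [Nat.cast_succ] at h3
      refine abs_le_of_sq_le_sq' ?_ (by positivity) |>.2
      simp only [b] at hn
      nlinarith [norm_nonneg x]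
    rw [Filter.frequently_atTop] at h2 ⊢
    intro a
    obtain ⟨n, hn, hn'⟩ := h2 a
    exact ⟨n + 1, by omega, hn'⟩
  rw [← hGc.submodule_topologicalClosure_eq, ← Submodule.orthogonal_orthogonal_eq_closure,
    Submodule.mem_orthogonal]
  intro v hv
  -- For `v` orthogonal to `G`, the product `⟪v, Tⁿ (z n)⟫` equals `⟪v, x⟫` for every `n`.
  refine eq_zero_of_frequently_bounded T zero_le_one (fun x => by simpa using hexp x) hT hfreq
    (v := v) fun n => ?_
  have := (Submodule.mem_orthogonal' _ _).1 hv _ (hmem n)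
  rw [inner_sub_right, sub_eq_zero] at this
  exact this.symm

/-- For a contraction with `‖T x + y‖² ≤ 2 (‖x‖² + ‖T y‖²)` and `⋂ T ^ n H = 0`, the space is
generated by `H ⊖ T H`. -/
theorem eq_top_of_contraction (T : H →L[ℂ] H) (hcon : ∀ x, ‖T x‖ ≤ ‖x‖)
    (hineq : ∀ x y, ‖T x + y‖ ^ 2 ≤ 2 * (‖x‖ ^ 2 + ‖T y‖ ^ 2))
    (hT : ∀ x, (∀ n, ∃ y, (T ^ n) y = x) → x = 0)
    (G : Submodule ℂ H) (hGc : IsClosed (G : Set H)) (hGi : ∀ x ∈ G, T x ∈ G)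
    (hG : (LinearMap.range (T : H →ₗ[ℂ] H))ᗮ ≤ G) : G = ⊤ := by
  -- The inequality at `x = 0` reads `‖y‖² ≤ 2‖Ty‖²`; the constant `2` in place of `√2` is good
  -- enough.
  have hcl := isClosed_range_of_le T (c := 2) zero_le_two fun x => by
    have := hineq 0 x
    simp only [map_zero, zero_add, norm_zero] at this
    refine abs_le_of_sq_le_sq' ?_ (by positivity) |>.2
    nlinarith [norm_nonneg (T x)]
  have : CompleteSpace G := hGc.completeSpace_coe
  rw [← Submodule.orthogonal_eq_bot_iff, eq_bot_iff]
  intro z hz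
  let A : H →L[ℂ] H := ContinuousLinearMap.adjoint T
  let s : ℕ → H := fun n => (A ^ n) z
  have hs : ∀ n, s (n + 1) = A (s n) := fun n => clm_pow_succ_apply' A n z
  have hsG : ∀ n, s n ∈ Gᗮ := by
    intro n
    induction n with
    | zero => simpa [s] using hz
    | succ n ih =>
      rw [Submodule.mem_orthogonal]
      intro g hg
      rw [hs, ContinuousLinearMap.adjoint_inner_right]
      exact (Submodule.mem_orthogonal _ _).1 ih _ (hGi g hg)
  have hrange : ∀ n, ∃ y, T y = s n := by
    intro n
    have h1 : s n ∈ (LinearMap.range (T : H →ₗ[ℂ] H))ᗮᗮ := Submodule.orthogonal_le hG (hsG n)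
    rwa [Submodule.orthogonal_orthogonal_eq_closure, hcl.submodule_topologicalClosure_eq] at h1
  -- Write `s n = T y`. The left side `Q` equals `⟪T (s (n + 2)) + y, s (n + 1)⟫`, so Cauchy–Schwarz
  -- and the hypothesis give `Q² ≤ 2Q‖s (n + 1)‖²`.
  have hconc : ∀ n, ‖s (n + 2)‖ ^ 2 + ‖s n‖ ^ 2 ≤ 2 * ‖s (n + 1)‖ ^ 2 := by
    intro n
    obtain ⟨y, hy⟩ := hrange n
    have h1 : inner ℂ (T (s (n + 2)) + y) (s (n + 1))
        = ((‖s (n + 2)‖ ^ 2 + ‖s n‖ ^ 2 : ℝ) : ℂ) := by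
      rw [inner_add_left]
      nth_rewrite 2 [hs n]
      rw [ContinuousLinearMap.adjoint_inner_right, hy, ← ContinuousLinearMap.adjoint_inner_right,
        ← hs (n + 1), inner_self_eq_norm_sq_to_K, inner_self_eq_norm_sq_to_K]
      push_cast; rfl
    have h2 := norm_inner_le_norm (𝕜 := ℂ) (T (s (n + 2)) + y) (s (n + 1))
    rw [h1, Complex.norm_real, Real.norm_eq_abs, abs_of_nonneg (by positivity)] at h2
    have h3 := hineq (s (n + 2)) y
    rw [hy] at h3
    set Q := ‖s (n + 2)‖ ^ 2 + ‖s n‖ ^ 2 with hQ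
    have hQ0 : 0 ≤ Q := by positivity
    rcases hQ0.eq_or_lt with h0 | hpos
    · rw [← h0]; positivity
    · have h4 : Q ^ 2 ≤ (2 * Q) * ‖s (n + 1)‖ ^ 2 := by
        calc Q ^ 2 ≤ (‖T (s (n + 2)) + y‖ * ‖s (n + 1)‖) ^ 2 := pow_le_pow_left₀ hQ0 h2 2
          _ = ‖T (s (n + 2)) + y‖ ^ 2 * ‖s (n + 1)‖ ^ 2 := by ring
          _ ≤ _ := by gcongr
      nlinarith
  have hAle : ∀ x, ‖A x‖ ≤ ‖x‖ := by
    intro x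
    have h1 : ‖A‖ ≤ 1 := by
      rw [LinearIsometryEquiv.norm_map]
      exact T.opNorm_le_bound zero_le_one fun x => by simpa using hcon x
    simpa using A.le_of_opNorm_le h1 x
  have hanti : ∀ n, ‖s (n + 1)‖ ^ 2 ≤ ‖s n‖ ^ 2 := fun n => by
    rw [hs]; exact pow_le_pow_left₀ (norm_nonneg _) (hAle _) 2
  -- A concave decreasing sequence that stays nonnegative is constant: one strict decrease `δ` would
  -- recur at each later step.
  have hconst : ∀ n, ‖s (n + 1)‖ ^ 2 = ‖s n‖ ^ 2 := by
    intro n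
    by_contra hne
    have hlt : 0 < ‖s n‖ ^ 2 - ‖s (n + 1)‖ ^ 2 :=
      sub_pos.2 (lt_of_le_of_ne (hanti n) hne)
    set δ := ‖s n‖ ^ 2 - ‖s (n + 1)‖ ^ 2 with hδ
    have h1 : ∀ k, δ ≤ ‖s (n + k)‖ ^ 2 - ‖s (n + k + 1)‖ ^ 2 := by
      intro k
      induction k with
      | zero => exact le_rfl
      | succ k ih =>
        have := hconc (n + k)
        rw [show n + (k + 1) = n + k + 1 by ring]
        rw [show n + k + 1 + 1 = n + k + 2 by ring]
        linarith
    have h2 : ∀ k : ℕ, ‖s (n + k)‖ ^ 2 ≤ ‖s n‖ ^ 2 - k * δ := by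
      intro k
      induction k with
      | zero => simp
      | succ k ih =>
        have := h1 k
        rw [show n + (k + 1) = n + k + 1 by ring]
        push_cast
        linarith
    obtain ⟨k, hk⟩ := exists_nat_gt (‖s n‖ ^ 2 / δ)
    rw [div_lt_iff₀ hlt] at hk
    nlinarith [h2 k, norm_nonneg (s (n + k))]
  -- Equal norms force `T T* (s n) = s n`, so `z = Tⁿ (s n)` lies in every `TⁿH`.
  have hTs : ∀ n, T (s (n + 1)) = s n := by
    intro n
    have h1 : ‖T (s (n + 1)) - s n‖ ^ 2 = ‖T (s (n + 1))‖ ^ 2 - 2 * ‖s (n + 1)‖ ^ 2 + ‖s n‖ ^ 2 := by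
      rw [@norm_sub_sq ℂ]
      have : inner ℂ (T (s (n + 1))) (s n) = ((‖s (n + 1)‖ ^ 2 : ℝ) : ℂ) := by
        rw [← ContinuousLinearMap.adjoint_inner_right]
        change inner ℂ (s (n + 1)) (A (s n)) = _
        rw [← hs, inner_self_eq_norm_sq_to_K]
        push_cast; rfl
      rw [this, RCLike.re_eq_complex_re, Complex.ofReal_re]
    have h2 := pow_le_pow_left₀ (norm_nonneg _) (hcon (s (n + 1))) 2
    have h3 := hconst n
    have h4 : ‖T (s (n + 1)) - s n‖ ^ 2 ≤ 0 := by linarith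
    exact sub_eq_zero.1 (norm_eq_zero.1 (pow_eq_zero_iff two_ne_zero |>.1
      (le_antisymm h4 (sq_nonneg _))))
  refine (Submodule.mem_bot ℂ).2 (hT z fun n => ⟨s n, ?_⟩)
  induction n with
  | zero => simp [s]
  | succ n ih => rw [clm_pow_succ_apply, hTs, ih]

/-- The three hypotheses are inherited by the restriction of `T` to any closed invariant subspace,
and that is all that `eq_top_of_concave` needs. -/
theorem hasWSP_of_concave (T : H →L[ℂ] H) (hexp : ∀ x, ‖x‖ ≤ ‖T x‖)
    (hconc : ∀ x, ‖T (T x)‖ ^ 2 + ‖x‖ ^ 2 ≤ 2 * ‖T x‖ ^ 2)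
    (hT : ∀ x, (∀ n, ∃ y, (T ^ n) y = x) → x = 0) : HasWSP (T : H →ₗ[ℂ] H) := by
  intro M hM
  refine generated_wandering_eq hM ?_
  have : CompleteSpace M := hM.1.completeSpace_coe
  let S : M →L[ℂ] M := (T.comp M.subtypeL).codRestrict M fun x => hM.2 x x.2
  have hS : ∀ n x, (((S ^ n) x : M) : H) = (T ^ n) x := by
    intro n
    induction n with
    | zero => intro x; simp
    | succ n ih =>
      intro x
      rw [clm_pow_succ_apply, clm_pow_succ_apply, ih]
      rfl
  refine eq_top_of_concave S (fun x => hexp x) (fun x => hconc x) fun x hx => ?_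
  refine Subtype.ext (hT x fun n => ?_)
  obtain ⟨y, rfl⟩ := hx n
  exact ⟨y, (hS n y).symm⟩

theorem hasWSP_of_contraction (T : H →L[ℂ] H) (hcon : ∀ x, ‖T x‖ ≤ ‖x‖)
    (hineq : ∀ x y, ‖T x + y‖ ^ 2 ≤ 2 * (‖x‖ ^ 2 + ‖T y‖ ^ 2))
    (hT : ∀ x, (∀ n, ∃ y, (T ^ n) y = x) → x = 0) : HasWSP (T : H →ₗ[ℂ] H) := by
  intro M hM
  refine generated_wandering_eq hM ?_
  have : CompleteSpace M := hM.1.completeSpace_coe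
  let S : M →L[ℂ] M := (T.comp M.subtypeL).codRestrict M fun x => hM.2 x x.2
  have hS : ∀ n x, (((S ^ n) x : M) : H) = (T ^ n) x := by
    intro n
    induction n with
    | zero => intro x; simp
    | succ n ih =>
      intro x
      rw [clm_pow_succ_apply, clm_pow_succ_apply, ih]
      rfl
  refine eq_top_of_contraction S (fun x => hcon x) (fun x y => hineq x y) fun x hx => ?_
  refine Subtype.ext (hT x fun n => ?_)
  obtain ⟨y, rfl⟩ := hx n
  exact ⟨y, (hS n y).symm⟩

end HilbertSpace

end DirichletWandering

namespace DirichletWandering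

/-! ### Weighted shifts of multiplicity `N`. -/

section Shift

variable {H : Type*} [NormedAddCommGroup H] [InnerProductSpace ℂ H]
  {T : H →L[ℂ] H} {V : H →ₗ[ℂ] (ℕ → ℂ)} {w : ℕ → ℝ} {N : ℕ} {u : ℂ}

theorem hasSum_norm_sq_shift {T : H →ₗ[ℂ] H} (hu : ‖u‖ = 1)
    (hnorm : ∀ f, HasSum (fun m => w m * ‖V f m‖ ^ 2) (‖f‖ ^ 2))
    (hshift : ∀ f m, V (T f) (m + N) = u * V f m) (hzero : ∀ f, ∀ m < N, V (T f) m = 0) (f : H) :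
    HasSum (fun m => w (m + N) * ‖V f m‖ ^ 2) (‖T f‖ ^ 2) := by
  have h := (hasSum_nat_add_iff' N).2 (hnorm (T f))
  rw [Finset.sum_eq_zero, sub_zero] at h
  · simpa only [hshift, norm_mul, hu, one_mul] using h
  · intro m hm
    rw [hzero f m (Finset.mem_range.1 hm)]; simp

/-- Each application of `T` adds at least one leading zero coefficient, so a vector in every `TⁿH`
has no nonzero coefficient. -/
theorem eq_zero_of_mem_range_pow (hN : 1 ≤ N)
    (hnorm : ∀ f, HasSum (fun m => w m * ‖V f m‖ ^ 2) (‖f‖ ^ 2))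
    (hshift : ∀ f m, V (T f) (m + N) = u * V f m) (hzero : ∀ f, ∀ m < N, V (T f) m = 0) (x : H)
    (hx : ∀ n, ∃ y, (T ^ n) y = x) : x = 0 := by
  have hV : ∀ n, ∀ m < n, ∀ y, V ((T ^ n) y) m = 0 := by
    intro n
    induction n with
    | zero => intro m hm; omega
    | succ n ih =>
      intro m hm y
      rw [clm_pow_succ_apply']
      rcases lt_or_ge m N with h | h
      · exact hzero _ m h
      · obtain ⟨j, rfl⟩ := Nat.exists_eq_add_of_le' h
        rw [hshift, ih j (by omega), mul_zero]
  have hx0 : ∀ m, V x m = 0 := fun m => by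
    obtain ⟨y, rfl⟩ := hx (m + 1)
    exact hV (m + 1) m m.lt_succ_self y
  have h := hnorm x
  simp only [hx0, norm_zero] at h
  have h0 : HasSum (fun m : ℕ => w m * (0 : ℝ) ^ 2) 0 := by simp
  simpa using h.unique h0

variable [CompleteSpace H]

theorem hasWSP_of_shift_concave (hN : 1 ≤ N) (hu : ‖u‖ = 1)
    (hnorm : ∀ f, HasSum (fun m => w m * ‖V f m‖ ^ 2) (‖f‖ ^ 2))
    (hshift : ∀ f m, V (T f) (m + N) = u * V f m) (hzero : ∀ f, ∀ m < N, V (T f) m = 0)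
    (hmono : ∀ m, w m ≤ w (m + N)) (hconc : ∀ m, w (m + N + N) + w m ≤ 2 * w (m + N)) :
    HasWSP (T : H →ₗ[ℂ] H) := by
  have hT : ∀ f, HasSum (fun m => w (m + N) * ‖V f m‖ ^ 2) (‖T f‖ ^ 2) :=
    hasSum_norm_sq_shift (T := (T : H →ₗ[ℂ] H)) hu hnorm hshift hzero
  refine hasWSP_of_concave T (fun x => ?_) (fun x => ?_)
    (eq_zero_of_mem_range_pow hN hnorm hshift hzero)
  · refine abs_le_of_sq_le_sq' (hasSum_le (fun m => ?_) (hnorm x) (hT x)) (norm_nonneg _) |>.2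
    exact mul_le_mul_of_nonneg_right (hmono m) (sq_nonneg _)
  · have hTT : HasSum (fun m => w (m + N + N) * ‖V x m‖ ^ 2) (‖T (T x)‖ ^ 2) := by
      have h := (hasSum_nat_add_iff' N).2 (hT (T x))
      rw [Finset.sum_eq_zero, sub_zero] at h
      · simpa only [hshift, norm_mul, hu, one_mul] using h
      · intro m hm
        rw [hzero x m (Finset.mem_range.1 hm)]; simp
    refine hasSum_le (fun m => ?_) (hTT.add (hnorm x)) ((hT x).mul_left 2)
    rw [← add_mul, ← mul_assoc]
    exact mul_le_mul_of_nonneg_right (hconc m) (sq_nonneg _)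

/-- This is weighted Cauchy–Schwarz, `‖a + b‖² ≤ (1/p + 1/r)(p‖a‖² + r‖b‖²)`. -/
theorem mul_norm_add_sq_le {p q r : ℝ} (hp : 0 < p) (hq : 0 < q) (hr : 0 < r)
    (h : q / p + q / r ≤ 2) (a b : ℂ) : q * ‖a + b‖ ^ 2 ≤ 2 * (p * ‖a‖ ^ 2 + r * ‖b‖ ^ 2) := by
  have h1 : ‖a + b‖ ^ 2 ≤ (1 / p + 1 / r) * (p * ‖a‖ ^ 2 + r * ‖b‖ ^ 2) := by
    have h2 : ‖a + b‖ ^ 2 ≤ (‖a‖ + ‖b‖) ^ 2 :=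
      pow_le_pow_left₀ (norm_nonneg _) (norm_add_le a b) 2
    refine h2.trans ?_
    have h3 : (1 / p + 1 / r) * (p * ‖a‖ ^ 2 + r * ‖b‖ ^ 2) - (‖a‖ + ‖b‖) ^ 2
        = (p * ‖a‖ - r * ‖b‖) ^ 2 / (p * r) := by
      field_simp
      ring
    have h4 : 0 ≤ (p * ‖a‖ - r * ‖b‖) ^ 2 / (p * r) := by positivity
    linarith
  calc q * ‖a + b‖ ^ 2 ≤ q * ((1 / p + 1 / r) * (p * ‖a‖ ^ 2 + r * ‖b‖ ^ 2)) := by gcongr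
    _ = (q / p + q / r) * (p * ‖a‖ ^ 2 + r * ‖b‖ ^ 2) := by ring
    _ ≤ _ := by gcongr

/-- The inequality `‖Tx + y‖² ≤ 2(‖x‖² + ‖Ty‖²)` is checked coefficient by coefficient. `hdual` is
midpoint concavity of `1 / w` with step `N`; `htwo` serves the coefficients below `N`, to which `Tx`
does not contribute. -/
theorem hasWSP_of_shift_contraction (hN : 1 ≤ N) (hu : ‖u‖ = 1) (hw : ∀ m, 0 < w m)
    (hnorm : ∀ f, HasSum (fun m => w m * ‖V f m‖ ^ 2) (‖f‖ ^ 2))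
    (hshift : ∀ f m, V (T f) (m + N) = u * V f m) (hzero : ∀ f, ∀ m < N, V (T f) m = 0)
    (hanti : ∀ m, w (m + N) ≤ w m) (htwo : ∀ m, w m ≤ 2 * w (m + N))
    (hdual : ∀ m, w (m + N) / w m + w (m + N) / w (m + N + N) ≤ 2) :
    HasWSP (T : H →ₗ[ℂ] H) := by
  have hT : ∀ f, HasSum (fun m => w (m + N) * ‖V f m‖ ^ 2) (‖T f‖ ^ 2) :=
    hasSum_norm_sq_shift (T := (T : H →ₗ[ℂ] H)) hu hnorm hshift hzero
  refine hasWSP_of_contraction T (fun x => ?_) (fun x y => ?_)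
    (eq_zero_of_mem_range_pow hN hnorm hshift hzero)
  · refine abs_le_of_sq_le_sq' (hasSum_le (fun m => ?_) (hT x) (hnorm x)) (norm_nonneg _) |>.2
    exact mul_le_mul_of_nonneg_right (hanti m) (sq_nonneg _)
  · let s : ℕ → ℝ := fun m => if m < N then 0 else w (m - N) * ‖V x (m - N)‖ ^ 2
    have hs : HasSum s (‖x‖ ^ 2) := by
      refine (hasSum_nat_add_iff' N).1 ?_
      rw [Finset.sum_eq_zero, sub_zero]
      · simpa [s] using hnorm x
      · intro m hm
        simp [s, Finset.mem_range.1 hm]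
    refine hasSum_le (fun m => ?_) (hnorm (T x + y)) ((hs.add (hT y)).mul_left 2)
    rw [map_add, Pi.add_apply]
    rcases lt_or_ge m N with h | h
    · simp only [s, h, if_true, hzero x m h, zero_add]
      rw [← mul_assoc]
      exact mul_le_mul_of_nonneg_right (htwo m) (sq_nonneg _)
    · obtain ⟨j, rfl⟩ := Nat.exists_eq_add_of_le' h
      have := mul_norm_add_sq_le (hw j) (hw (j + N)) (hw (j + N + N)) (hdual j)
        (u * V x j) (V y (j + N))
      simpa [s, hshift, hu] using this

/-- This makes the shift bounded, so that a merely linear operator can be treated as a continuous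
one. -/
theorem exists_rpow_add_le (α : ℝ) {c : ℝ} (hc : 0 < c) (N : ℕ) :
    ∃ K, 0 ≤ K ∧ ∀ m : ℕ, (((m + N : ℕ) : ℝ) + c) ^ α ≤ K * ((m : ℝ) + c) ^ α := by
  rcases le_or_gt 0 α with h0 | h0
  · refine ⟨((N + c) / c) ^ α, by positivity, fun m => ?_⟩
    rw [← Real.mul_rpow (by positivity) (by positivity)]
    refine Real.rpow_le_rpow (by positivity) ?_ h0
    rw [div_mul_eq_mul_div, le_div_iff₀ hc]
    push_cast
    nlinarith [mul_nonneg (Nat.cast_nonneg (α := ℝ) N) (Nat.cast_nonneg (α := ℝ) m)]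
  · refine ⟨1, zero_le_one, fun m => ?_⟩
    rw [one_mul]
    exact Real.rpow_le_rpow_of_nonpos (by positivity) (by push_cast; simp) h0.le

/-- The weighted shifts with weights `(m + c) ^ α`, of multiplicity `N`, have the wandering
subspace property. -/
theorem hasWSP_of_shift {T : H →ₗ[ℂ] H} {α c : ℝ} (hα : α ∈ Set.Icc (-1 : ℝ) 1) (hc : 0 < c)
    (hαc : α < 0 → ((N + c) / c) ^ (-α) ≤ 2) (hN : 1 ≤ N) (hu : ‖u‖ = 1)
    (hnorm : ∀ f, HasSum (fun m : ℕ => ((m : ℝ) + c) ^ α * ‖V f m‖ ^ 2) (‖f‖ ^ 2))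
    (hshift : ∀ f m, V (T f) (m + N) = u * V f m) (hzero : ∀ f, ∀ m < N, V (T f) m = 0) :
    HasWSP T := by
  have hconcave : ∀ β ∈ Set.Icc (0 : ℝ) 1, ∀ m : ℕ, (((m + N + N : ℕ) : ℝ) + c) ^ β
      + ((m : ℝ) + c) ^ β ≤ 2 * (((m + N : ℕ) : ℝ) + c) ^ β := by
    intro β hβ m
    have hx : ((m + N + N : ℕ) : ℝ) + c ∈ Set.Ici (0 : ℝ) := Set.mem_Ici.2 (by positivity)
    have hy : (m : ℝ) + c ∈ Set.Ici (0 : ℝ) := Set.mem_Ici.2 (by positivity)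
    have h := (Real.concaveOn_rpow hβ.1 hβ.2).2 hx hy (by norm_num : (0 : ℝ) ≤ 1 / 2)
      (by norm_num : (0 : ℝ) ≤ 1 / 2) (by norm_num)
    have he : (1 / 2 : ℝ) • (((m + N + N : ℕ) : ℝ) + c) + (1 / 2 : ℝ) • ((m : ℝ) + c)
        = ((m + N : ℕ) : ℝ) + c := by
      simp only [smul_eq_mul]; push_cast; ring
    rw [he] at h
    simp only [smul_eq_mul] at h
    linarith
  have hNm : ∀ m : ℕ, (m : ℝ) + c ≤ ((m + N : ℕ) : ℝ) + c := fun m => by push_cast; simp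
  have hpos : ∀ m : ℕ, 0 < (m : ℝ) + c := fun m => by positivity
  have hbound : ∃ K, ∀ f, ‖T f‖ ≤ K * ‖f‖ := by
    obtain ⟨K, hK0, hK⟩ := exists_rpow_add_le α hc N
    refine ⟨√K, fun f => ?_⟩
    have h := hasSum_le (fun m => ?_) (hasSum_norm_sq_shift hu hnorm hshift hzero f)
      ((hnorm f).mul_left K)
    · refine abs_le_of_sq_le_sq' ?_ (by positivity) |>.2
      rwa [mul_pow, Real.sq_sqrt hK0]
    · rw [← mul_assoc]
      exact mul_le_mul_of_nonneg_right (hK m) (sq_nonneg _)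
  let S : H →L[ℂ] H := T.mkContinuousOfExistsBound hbound
  change HasWSP (S : H →ₗ[ℂ] H)
  rcases le_or_gt 0 α with h0 | h0
  · refine hasWSP_of_shift_concave (w := fun m : ℕ => ((m : ℝ) + c) ^ α) hN hu hnorm hshift hzero
      (fun m => ?_) (hconcave α ⟨h0, hα.2⟩)
    exact Real.rpow_le_rpow (hpos m).le (hNm m) h0
  · have hinv : ∀ m : ℕ, ((m : ℝ) + c) ^ α = (((m : ℝ) + c) ^ (-α))⁻¹ := fun m => by
      rw [Real.rpow_neg (hpos m).le, inv_inv]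
    have hp : ∀ m : ℕ, 0 < ((m : ℝ) + c) ^ (-α) := fun m => Real.rpow_pos_of_pos (hpos m) _
    refine hasWSP_of_shift_contraction (w := fun m : ℕ => ((m : ℝ) + c) ^ α) hN hu
      (fun m => Real.rpow_pos_of_pos (hpos m) _) hnorm hshift hzero (fun m => ?_) (fun m => ?_)
      fun m => ?_
    · exact Real.rpow_le_rpow_of_nonpos (hpos m) (hNm m) h0.le
    · simp only [hinv]
      -- The ratio `(m + N + c) / (m + c)` is largest at `m = 0`, where `hαc` controls it.
      have h1 : (((m + N : ℕ) : ℝ) + c) ^ (-α) ≤ 2 * ((m : ℝ) + c) ^ (-α) := by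
        refine le_trans ?_ (mul_le_mul_of_nonneg_right (hαc h0) (hp m).le)
        rw [← Real.mul_rpow (by positivity) (hpos m).le]
        refine Real.rpow_le_rpow (by positivity) ?_ (by linarith)
        rw [div_mul_eq_mul_div, le_div_iff₀ hc]
        push_cast
        nlinarith [mul_nonneg (Nat.cast_nonneg (α := ℝ) N) (Nat.cast_nonneg (α := ℝ) m)]
      rw [inv_eq_one_div, ← div_eq_mul_inv, div_le_div_iff₀ (hp m) (hp _)]
      linarith
    · simp only [hinv]
      have h1 := hconcave (-α) ⟨by linarith, by linarith [hα.1]⟩ m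
      have h2 := hp m
      have h3 := hp (m + N)
      rw [div_inv_eq_mul, div_inv_eq_mul, ← mul_add, inv_mul_le_iff₀ h3]
      linarith

end Shift

end DirichletWandering

namespace DirichletWandering

/-! ### Power series and their `ℓ¹` coefficient norms at a radius `r`. -/

section WienerNorm

open PowerSeries

/-- The power series `f` converges absolutely at radius `r`. -/
def SummableAt (r : ℝ) (f : PowerSeries ℂ) : Prop :=
  Summable fun n => ‖coeff n f‖ * r ^ n

/-- The `ℓ¹` norm `∑ |f_n| r ^ n` of the coefficients of `f` at radius `r`. -/
noncomputable def wienerNorm (r : ℝ) (f : PowerSeries ℂ) : ℝ :=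
  ∑' n, ‖coeff n f‖ * r ^ n

/-- The power series `f` converges in the open unit disc. -/
def ConvergesInDisc (f : PowerSeries ℂ) : Prop :=
  ∀ r : ℝ, 0 ≤ r → r < 1 → SummableAt r f

variable {r : ℝ} {f g : PowerSeries ℂ}

theorem wienerNorm_nonneg (hr : 0 ≤ r) (f : PowerSeries ℂ) : 0 ≤ wienerNorm r f :=
  tsum_nonneg fun n => by positivity

theorem norm_coeff_mul_le (hr : 0 ≤ r) (f g : PowerSeries ℂ) (n : ℕ) :
    ‖coeff n (f * g)‖ * r ^ n ≤ ∑ p ∈ Finset.HasAntidiagonal.antidiagonal n,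
      (‖coeff p.1 f‖ * r ^ p.1) * (‖coeff p.2 g‖ * r ^ p.2) := by
  rw [coeff_mul]
  refine (mul_le_mul_of_nonneg_right (norm_sum_le _ _) (by positivity)).trans_eq ?_
  rw [Finset.sum_mul]
  refine Finset.sum_congr rfl fun p hp => ?_
  rw [← Finset.HasAntidiagonal.mem_antidiagonal.1 hp, norm_mul, pow_add]
  ring

theorem SummableAt.summable_norm (hr : 0 ≤ r) (hf : SummableAt r f) :
    Summable fun n => ‖‖coeff n f‖ * r ^ n‖ := by
  refine hf.congr fun n => ?_
  rw [Real.norm_of_nonneg (by positivity)]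

theorem SummableAt.mul (hr : 0 ≤ r) (hf : SummableAt r f) (hg : SummableAt r g) :
    SummableAt r (f * g) :=
  Summable.of_nonneg_of_le (fun n => by positivity) (norm_coeff_mul_le hr f g)
    (summable_norm_sum_mul_antidiagonal_of_summable_norm (hf.summable_norm hr)
      (hg.summable_norm hr)).of_norm

/-- Submultiplicativity lets the coefficients of long Blaschke products be estimated factor by
factor. -/
theorem wienerNorm_mul_le (hr : 0 ≤ r) (hf : SummableAt r f) (hg : SummableAt r g) :
    wienerNorm r (f * g) ≤ wienerNorm r f * wienerNorm r g := by
  rw [wienerNorm, wienerNorm, wienerNorm, tsum_mul_tsum_eq_tsum_sum_antidiagonal_of_summable_norm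
    (hf.summable_norm hr) (hg.summable_norm hr)]
  exact (hf.mul hr hg).tsum_le_tsum (norm_coeff_mul_le hr f g)
    (summable_norm_sum_mul_antidiagonal_of_summable_norm (hf.summable_norm hr)
      (hg.summable_norm hr)).of_norm

theorem norm_coeff_mul_pow_le (hr : 0 ≤ r) (hf : SummableAt r f) (n : ℕ) :
    ‖coeff n f‖ * r ^ n ≤ wienerNorm r f :=
  hf.le_tsum n fun _ _ => by positivity

theorem SummableAt.add (hf : SummableAt r f) (hg : SummableAt r g) (hr : 0 ≤ r) :
    SummableAt r (f + g) := by
  refine Summable.of_nonneg_of_le (fun n => by positivity) (fun n => ?_) (Summable.add hf hg)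
  rw [map_add, ← add_mul]
  gcongr
  exact norm_add_le _ _

theorem wienerNorm_add_le (hf : SummableAt r f) (hg : SummableAt r g) (hr : 0 ≤ r) :
    wienerNorm r (f + g) ≤ wienerNorm r f + wienerNorm r g := by
  rw [wienerNorm, wienerNorm, wienerNorm, ← Summable.tsum_add hf hg]
  refine (hf.add hg hr).tsum_le_tsum (fun n => ?_) (Summable.add hf hg)
  rw [map_add, ← add_mul]
  gcongr
  exact norm_add_le _ _

theorem hasSum_wienerNorm_C (r : ℝ) (c : ℂ) :
    HasSum (fun n => ‖coeff n (C c)‖ * r ^ n) ‖c‖ := by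
  have h := hasSum_single (f := fun n => ‖coeff n (C c)‖ * r ^ n) 0 fun n hn => by
    simp [coeff_C, hn]
  simpa using h

theorem hasSum_wienerNorm_X (r : ℝ) :
    HasSum (fun n => ‖coeff n (X : PowerSeries ℂ)‖ * r ^ n) r := by
  have h := hasSum_single (f := fun n => ‖coeff n (X : PowerSeries ℂ)‖ * r ^ n) 1 fun n hn => by
    simp [coeff_X, hn]
  simpa using h

theorem summableAt_C (r : ℝ) (c : ℂ) : SummableAt r (C c) := (hasSum_wienerNorm_C r c).summable

theorem summableAt_X (r : ℝ) : SummableAt r X := (hasSum_wienerNorm_X r).summable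

theorem wienerNorm_C (r : ℝ) (c : ℂ) : wienerNorm r (C c) = ‖c‖ := (hasSum_wienerNorm_C r c).tsum_eq

theorem wienerNorm_X (r : ℝ) : wienerNorm r X = r := (hasSum_wienerNorm_X r).tsum_eq

theorem SummableAt.mono {s : ℝ} (hr : 0 ≤ r) (hrs : r ≤ s) (hf : SummableAt s f) :
    SummableAt r f :=
  Summable.of_nonneg_of_le (fun n => by positivity) (fun n => by gcongr) hf

theorem SummableAt.convergesInDisc {s : ℝ} (hs : 1 ≤ s) (hf : SummableAt s f) :
    ConvergesInDisc f := fun _ hr hr1 => hf.mono hr (hr1.le.trans hs)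

theorem ConvergesInDisc.mul (hf : ConvergesInDisc f) (hg : ConvergesInDisc g) :
    ConvergesInDisc (f * g) := fun r hr hr1 => (hf r hr hr1).mul hr (hg r hr hr1)

theorem summableAt_prod {ι : Type*} (hr : 0 ≤ r) (s : Finset ι) {F : ι → PowerSeries ℂ}
    (h : ∀ i ∈ s, SummableAt r (F i)) : SummableAt r (∏ i ∈ s, F i) := by
  classical
  induction s using Finset.induction_on with
  | empty => simpa using summableAt_C r 1
  | insert i s hi ih =>
    rw [Finset.prod_insert hi]
    exact (h i (Finset.mem_insert_self i s)).mul hr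
      (ih fun j hj => h j (Finset.mem_insert_of_mem hj))

theorem wienerNorm_prod_le {ι : Type*} (hr : 0 ≤ r) (s : Finset ι) {F : ι → PowerSeries ℂ} {A : ℝ}
    (h : ∀ i ∈ s, SummableAt r (F i)) (hA : ∀ i ∈ s, wienerNorm r (F i) ≤ A) :
    wienerNorm r (∏ i ∈ s, F i) ≤ A ^ s.card := by
  classical
  induction s using Finset.induction_on with
  | empty => simpa using (wienerNorm_C r 1).le
  | insert i s hi ih =>
    rw [Finset.prod_insert hi, Finset.card_insert_of_notMem hi, pow_succ']
    have hs : ∀ j ∈ s, SummableAt r (F j) := fun j hj => h j (Finset.mem_insert_of_mem hj)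
    have hAi := hA i (Finset.mem_insert_self i s)
    refine (wienerNorm_mul_le hr (h i (Finset.mem_insert_self i s))
      (summableAt_prod hr s hs)).trans ?_
    exact mul_le_mul hAi (ih hs fun j hj => hA j (Finset.mem_insert_of_mem hj))
      (wienerNorm_nonneg hr _) ((wienerNorm_nonneg hr _).trans hAi)

end WienerNorm

/-! ### Szegő kernels and Blaschke factors as power series. -/

section Kernel

open PowerSeries

/-- The power series of the Szegő kernel `1 / (1 - conj a z)`. -/
noncomputable def szego (a : ℂ) : PowerSeries ℂ := PowerSeries.mk fun n => conj a ^ n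

/-- The power series of the Blaschke factor `(z - a) / (1 - conj a z)`. -/
noncomputable def factor (a : ℂ) : PowerSeries ℂ := (X - C a) * szego a

theorem coeff_szego (a : ℂ) (n : ℕ) : coeff n (szego a) = conj a ^ n := coeff_mk _ _

theorem one_sub_mul_szego (a : ℂ) : (1 - C (conj a) * X) * szego a = 1 := by
  ext n
  rw [sub_mul, one_mul, map_sub, mul_assoc, coeff_C_mul, coeff_szego]
  cases n with
  | zero => simp
  | succ n =>
    rw [coeff_succ_X_mul, coeff_szego, coeff_one]
    simp [pow_succ']

/-- Splitting off the value at the origin makes the norm at a small radius close to `‖a‖`, hence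
below `1`. -/
theorem factor_eq (a : ℂ) :
    factor a = C (-a) + C ((1 - ‖a‖ ^ 2 : ℝ) : ℂ) * X * szego a := by
  have h : (C (-a) + C ((1 - ‖a‖ ^ 2 : ℝ) : ℂ) * X * szego a) * 1
      = (X - C a) * szego a := by
    have hc : C ((1 - ‖a‖ ^ 2 : ℝ) : ℂ) = 1 - C (conj a) * C a := by
      rw [← map_mul, Complex.conj_mul']; push_cast; simp
    rw [hc, map_neg]
    linear_combination (C a) * one_sub_mul_szego a
  rw [factor, ← h, mul_one]

variable {r : ℝ} {a : ℂ}

theorem hasSum_szego (hr : 0 ≤ r) (h : r * ‖a‖ < 1) :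
    HasSum (fun n => ‖coeff n (szego a)‖ * r ^ n) (1 - r * ‖a‖)⁻¹ := by
  refine (hasSum_geometric_of_lt_one (by positivity) h).congr_fun fun n => ?_
  rw [coeff_szego, norm_pow, RCLike.norm_conj, mul_pow, mul_comm]

theorem summableAt_szego (hr : 0 ≤ r) (h : r * ‖a‖ < 1) : SummableAt r (szego a) :=
  (hasSum_szego hr h).summable

theorem wienerNorm_szego (hr : 0 ≤ r) (h : r * ‖a‖ < 1) :
    wienerNorm r (szego a) = (1 - r * ‖a‖)⁻¹ := (hasSum_szego hr h).tsum_eq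

theorem summableAt_factor (hr : 0 ≤ r) (h : r * ‖a‖ < 1) : SummableAt r (factor a) := by
  rw [factor_eq]
  exact (summableAt_C r _).add (((summableAt_C r _).mul hr (summableAt_X r)).mul hr
    (summableAt_szego hr h)) hr

theorem wienerNorm_factor_le (hr : 0 ≤ r) (h : r * ‖a‖ < 1) (ha : ‖a‖ < 1) :
    wienerNorm r (factor a) ≤ ‖a‖ + r * (1 - r * ‖a‖)⁻¹ := by
  have h1 := (summableAt_C r ((1 - ‖a‖ ^ 2 : ℝ) : ℂ)).mul hr (summableAt_X r)
  have h2 := wienerNorm_mul_le hr (summableAt_C r ((1 - ‖a‖ ^ 2 : ℝ) : ℂ)) (summableAt_X r)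
  have h3 := wienerNorm_mul_le hr h1 (summableAt_szego hr h)
  have h4 := wienerNorm_add_le (summableAt_C r (-a)) (h1.mul hr (summableAt_szego hr h)) hr
  rw [← factor_eq, wienerNorm_C, norm_neg] at h4
  have h0 : ‖a‖ ^ 2 ≤ 1 := pow_le_one₀ (norm_nonneg a) ha.le
  rw [wienerNorm_C, wienerNorm_X, Complex.norm_real, Real.norm_of_nonneg (by linarith)] at h2
  rw [wienerNorm_szego hr h] at h3
  have h5 : (0 : ℝ) ≤ (1 - r * ‖a‖)⁻¹ := inv_nonneg.2 (by linarith)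
  have h6 : wienerNorm r (C ((1 - ‖a‖ ^ 2 : ℝ) : ℂ) * X) ≤ r := by
    nlinarith [sq_nonneg ‖a‖]
  nlinarith [mul_le_mul_of_nonneg_right h6 h5]

end Kernel

/-! ### The `H²` pairing and its invariance under Blaschke factors. -/

section Pairing

open PowerSeries

/-- The pairing `∑ f_n conj (g_n)` of two power series. -/
noncomputable def pair (f g : PowerSeries ℂ) : ℂ := ∑' n, coeff n f * conj (coeff n g)

variable {r : ℝ} {f f₁ f₂ g g₁ g₂ : PowerSeries ℂ} {a : ℂ}

/-- For `α < 0` functions in `D_α` need not lie in `H²`. The pairing still converges when the second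
series converges at some radius beyond `1`. -/
theorem summable_pair (hf : ConvergesInDisc f) (hr : 1 < r) (hg : SummableAt r g) :
    Summable fun n => coeff n f * conj (coeff n g) := by
  have hr0 : 0 < r := one_pos.trans hr
  have h1 := hf r⁻¹ (by positivity) (inv_lt_one_of_one_lt₀ hr)
  refine Summable.of_norm_bounded (Summable.mul_left (wienerNorm r⁻¹ f) hg) fun n => ?_
  have h2 := norm_coeff_mul_pow_le (by positivity) h1 n
  rw [inv_pow, ← div_eq_mul_inv, div_le_iff₀ (by positivity)] at h2
  rw [norm_mul, RCLike.norm_conj]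
  calc ‖coeff n f‖ * ‖coeff n g‖ ≤ wienerNorm r⁻¹ f * r ^ n * ‖coeff n g‖ := by gcongr
    _ = _ := by ring

theorem pair_conj_symm (f g : PowerSeries ℂ) : conj (pair f g) = pair g f := by
  rw [pair, pair, Complex.conj_tsum]
  exact tsum_congr fun n => by simp [mul_comm]

theorem pair_C_mul_left (c : ℂ) (f g : PowerSeries ℂ) : pair (C c * f) g = c * pair f g := by
  rw [pair, pair, ← tsum_mul_left]
  exact tsum_congr fun n => by rw [coeff_C_mul, mul_assoc]

theorem pair_C_mul_right (c : ℂ) (f g : PowerSeries ℂ) :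
    pair f (C c * g) = conj c * pair f g := by
  rw [← pair_conj_symm, pair_C_mul_left, map_mul, pair_conj_symm]

theorem pair_sub_left (hf₁ : ConvergesInDisc f₁) (hf₂ : ConvergesInDisc f₂) (hr : 1 < r)
    (hg : SummableAt r g) : pair (f₁ - f₂) g = pair f₁ g - pair f₂ g := by
  rw [pair, pair, pair, ← (summable_pair hf₁ hr hg).tsum_sub (summable_pair hf₂ hr hg)]
  exact tsum_congr fun n => by rw [map_sub, sub_mul]

theorem pair_add_right (hf : ConvergesInDisc f) (hr : 1 < r)
    (hg₁ : SummableAt r g₁) (hg₂ : SummableAt r g₂) :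
    pair f (g₁ + g₂) = pair f g₁ + pair f g₂ := by
  rw [pair, pair, pair, ← (summable_pair hf hr hg₁).tsum_add (summable_pair hf hr hg₂)]
  exact tsum_congr fun n => by rw [map_add, map_add, mul_add]

theorem pair_sub_right (hf : ConvergesInDisc f) (hr : 1 < r)
    (hg₁ : SummableAt r g₁) (hg₂ : SummableAt r g₂) :
    pair f (g₁ - g₂) = pair f g₁ - pair f g₂ := by
  rw [pair, pair, pair, ← (summable_pair hf hr hg₁).tsum_sub (summable_pair hf hr hg₂)]
  exact tsum_congr fun n => by rw [map_sub, map_sub, mul_sub]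

theorem pair_X_mul_X_mul (hf : ConvergesInDisc f) (hr : 1 < r) (hg : SummableAt r g) :
    pair (X * f) (X * g) = pair f g := by
  have hX : ConvergesInDisc X := fun r _ _ => summableAt_X r
  have hr0 : 0 ≤ r := by linarith
  rw [pair, (summable_pair (hX.mul hf) hr ((summableAt_X r).mul hr0 hg)).tsum_eq_zero_add]
  simp only [coeff_zero_X_mul, coeff_succ_X_mul, zero_mul, zero_add, pair]

theorem pair_szego (f : PowerSeries ℂ) (a : ℂ) :
    pair f (szego a) = ∑' n, coeff n f * a ^ n :=
  tsum_congr fun n => by rw [coeff_szego, map_pow, Complex.conj_conj]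

theorem exists_one_lt_mul_norm_lt_one (ha : ‖a‖ < 1) :
    ∃ r, 1 < r ∧ r * ‖a‖ < 1 := by
  refine ⟨2 / (1 + ‖a‖), ?_, ?_⟩
  · rw [lt_div_iff₀ (by positivity)]; linarith
  · rw [div_mul_eq_mul_div, div_lt_one (by positivity)]; linarith

theorem convergesInDisc_szego (ha : ‖a‖ < 1) : ConvergesInDisc (szego a) := by
  obtain ⟨r, hr, h⟩ := exists_one_lt_mul_norm_lt_one ha
  exact (summableAt_szego (by linarith) h).convergesInDisc hr.le

/-- Multiplication by a Blaschke factor preserves the pairing. -/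
theorem pair_factor_mul_factor_mul (hf : ConvergesInDisc f) (hr : 1 < r) (hg : SummableAt r g)
    (ha : ‖a‖ < 1) (hra : r * ‖a‖ < 1) : pair (factor a * f) (factor a * g) = pair f g := by
  have hr0 : 0 ≤ r := by linarith
  have hX : ConvergesInDisc X := fun r _ _ => summableAt_X r
  have hC : ∀ c, ConvergesInDisc (C c) := fun c r _ _ => summableAt_C r c
  set F := szego a * f with hF
  set G := szego a * g with hG
  have hFc : ConvergesInDisc F := (convergesInDisc_szego ha).mul hf
  have hGs : SummableAt r G := (summableAt_szego hr0 hra).mul hr0 hg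
  have e1 : factor a * f = X * F - C a * F := by rw [hF, factor]; ring
  have e2 : factor a * g = X * G - C a * G := by rw [hG, factor]; ring
  have e3 : f = F - C (conj a) * (X * F) := by
    rw [hF]; linear_combination (-f) * one_sub_mul_szego a
  have e4 : g = G - C (conj a) * (X * G) := by
    rw [hG]; linear_combination (-g) * one_sub_mul_szego a
  have hXF := hX.mul hFc
  have hXG := (summableAt_X r).mul hr0 hGs
  have hCF := (hC a).mul hFc
  have hCXF := (hC (conj a)).mul hXF
  have hCG := (summableAt_C r a).mul hr0 hGs
  have hCXG := (summableAt_C r (conj a)).mul hr0 hXG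
  -- With `F = f / (1 - conj a z)` and `G` likewise, both sides expand into the same four pairings
  -- once multiplication by `z` is known to preserve the pairing.
  have hs := pair_X_mul_X_mul hFc hr hGs
  rw [e1, e2, pair_sub_left hXF hCF hr (by
    rw [← e2]; exact (summableAt_factor hr0 hra).mul hr0 hg), pair_sub_right hXF hr hXG hCG,
    pair_sub_right hCF hr hXG hCG]
  conv_rhs => rw [e3]
  rw [pair_sub_left hFc hCXF hr hg]
  conv_rhs => rw [e4]
  rw [pair_sub_right hFc hr hGs hCXG, pair_sub_right hCXF hr hGs hCXG]
  simp only [pair_C_mul_left, pair_C_mul_right, hs, Complex.conj_conj]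
  ring

/-- A multiple of a Blaschke factor is orthogonal to the Szegő kernel of its zero. -/
theorem pair_factor_mul_szego (hf : ConvergesInDisc f) (ha : ‖a‖ < 1) :
    pair (factor a * f) (szego a) = 0 := by
  obtain ⟨r, hr, hra⟩ := exists_one_lt_mul_norm_lt_one ha
  have hr0 : 0 ≤ r := by linarith
  have hX : ConvergesInDisc X := fun r _ _ => summableAt_X r
  have hF : ConvergesInDisc (szego a * f) := (convergesInDisc_szego ha).mul hf
  have hs := summableAt_szego hr0 hra
  have e : factor a * f = X * (szego a * f) - C a * (szego a * f) := by rw [factor]; ring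
  rw [e, pair_sub_left (hX.mul hF) (ConvergesInDisc.mul (fun r _ _ => summableAt_C r a) hF) hr hs,
    pair_C_mul_left, pair, (summable_pair (hX.mul hF) hr hs).tsum_eq_zero_add, coeff_zero_X_mul,
    zero_mul, zero_add, pair, ← tsum_mul_left, sub_eq_zero]
  refine tsum_congr fun n => ?_
  rw [coeff_succ_X_mul, coeff_szego, coeff_szego, map_pow, map_pow, Complex.conj_conj]
  ring

theorem pair_szego_self (ha : ‖a‖ < 1) : pair (szego a) (szego a) = ((1 - ‖a‖ ^ 2 : ℝ) : ℂ)⁻¹ := by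
  rw [pair_szego]
  have h : ‖conj a * a‖ < 1 := by
    rw [norm_mul, RCLike.norm_conj]
    nlinarith [norm_nonneg a]
  have h1 := (hasSum_geometric_of_norm_lt_one h).tsum_eq
  rw [Complex.conj_mul'] at h1
  push_cast
  rw [← h1]
  refine tsum_congr fun n => ?_
  rw [coeff_szego, ← mul_pow, Complex.conj_mul']

end Pairing

end DirichletWandering

namespace DirichletWandering

/-! ### The Takenaka–Malmquist system: orthonormality and kernel expansion. -/

section TakenakaMalmquist

open PowerSeries

/-- The partial Blaschke product `∏_{i < m} (z - a_i) / (1 - conj a_i z)`. -/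
noncomputable def partialProd (a : ℕ → ℂ) (m : ℕ) : PowerSeries ℂ :=
  ∏ i ∈ Finset.range m, factor (a i)

/-- The Takenaka–Malmquist system of the sequence `a`. -/
noncomputable def takenaka (a : ℕ → ℂ) (m : ℕ) : PowerSeries ℂ :=
  C (√(1 - ‖a m‖ ^ 2) : ℂ) * (partialProd a m * szego (a m))

variable {a : ℕ → ℂ} {q r : ℝ} {f g : PowerSeries ℂ}

theorem summableAt_partialProd (hr : 0 ≤ r) (h : ∀ m, r * ‖a m‖ < 1) (m : ℕ) :
    SummableAt r (partialProd a m) :=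
  summableAt_prod hr _ fun i _ => summableAt_factor hr (h i)

theorem summableAt_takenaka (hr : 0 ≤ r) (h : ∀ m, r * ‖a m‖ < 1) (m : ℕ) :
    SummableAt r (takenaka a m) :=
  (summableAt_C r _).mul hr ((summableAt_partialProd hr h m).mul hr (summableAt_szego hr (h m)))

theorem exists_radius (hq : 0 ≤ q) (hq1 : q < 1) (ha : ∀ m, ‖a m‖ ≤ q) :
    ∃ r, 1 < r ∧ r * q < 1 ∧ ∀ m, r * ‖a m‖ < 1 := by
  obtain ⟨r, hr, hrq⟩ := exists_one_lt_mul_norm_lt_one (a := (q : ℂ))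
    (by rwa [Complex.norm_real, Real.norm_of_nonneg hq])
  rw [Complex.norm_real, Real.norm_of_nonneg hq] at hrq
  exact ⟨r, hr, hrq, fun m => (mul_le_mul_of_nonneg_left (ha m) (by linarith)).trans_lt hrq⟩

theorem convergesInDisc_prod (ha : ∀ m, ‖a m‖ < 1) (s : Finset ℕ) :
    ConvergesInDisc (∏ i ∈ s, factor (a i)) := fun r hr hr1 =>
  summableAt_prod hr s fun i _ => summableAt_factor hr
    (by nlinarith [ha i, norm_nonneg (a i)])

theorem pair_partialProd_mul (hf : ConvergesInDisc f) (hr : 1 < r) (hg : SummableAt r g)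
    (ha : ∀ m, ‖a m‖ < 1) (hra : ∀ m, r * ‖a m‖ < 1) (m : ℕ) :
    pair (partialProd a m * f) (partialProd a m * g) = pair f g := by
  have hr0 : 0 ≤ r := by linarith
  induction m with
  | zero => simp [partialProd]
  | succ m ih =>
    have e : ∀ h : PowerSeries ℂ, partialProd a (m + 1) * h
        = factor (a m) * (partialProd a m * h) := fun h => by
      rw [partialProd, Finset.prod_range_succ, ← partialProd]; ring
    rw [e, e, pair_factor_mul_factor_mul (f := partialProd a m * f)
      ((convergesInDisc_prod ha (Finset.range m)).mul hf) hr
      ((summableAt_partialProd hr0 hra m).mul hr0 hg) (ha m) (hra m), ih]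

/-- A multiple of a longer partial product is orthogonal to the Takenaka–Malmquist functions of
smaller index. -/
theorem pair_partialProd_mul_takenaka (hq : 0 ≤ q) (hq1 : q < 1) (ha : ∀ m, ‖a m‖ ≤ q)
    (hf : ConvergesInDisc f) {m l : ℕ} (hml : m < l) :
    pair (partialProd a l * f) (takenaka a m) = 0 := by
  obtain ⟨r, hr, -, hra⟩ := exists_radius hq hq1 ha
  have ha1 : ∀ m, ‖a m‖ < 1 := fun m => (ha m).trans_lt hq1
  have e : partialProd a l * f = partialProd a m * (factor (a m) *
      ((∏ i ∈ Finset.Ico (m + 1) l, factor (a i)) * f)) := by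
    rw [partialProd, ← Finset.prod_range_mul_prod_Ico _ (Nat.succ_le_of_lt hml),
      Finset.prod_range_succ, ← partialProd]
    ring
  have hR := (convergesInDisc_prod ha1 (Finset.Ico (m + 1) l)).mul hf
  rw [takenaka, pair_C_mul_right, e, pair_partialProd_mul ((show ConvergesInDisc (factor (a m)) from
    fun r hr hr1 => summableAt_factor hr (by nlinarith [ha1 m, norm_nonneg (a m)])).mul hR) hr
    (summableAt_szego (by linarith) (hra m)) ha1 hra, pair_factor_mul_szego hR (ha1 m), mul_zero]

theorem pair_takenaka_of_lt (hq : 0 ≤ q) (hq1 : q < 1) (ha : ∀ m, ‖a m‖ ≤ q)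
    {m l : ℕ} (hml : m < l) : pair (takenaka a l) (takenaka a m) = 0 := by
  rw [takenaka, pair_C_mul_left, pair_partialProd_mul_takenaka hq hq1 ha
    (convergesInDisc_szego ((ha l).trans_lt hq1)) hml, mul_zero]

theorem pair_takenaka_self (hq : 0 ≤ q) (hq1 : q < 1) (ha : ∀ m, ‖a m‖ ≤ q) (m : ℕ) :
    pair (takenaka a m) (takenaka a m) = 1 := by
  obtain ⟨r, hr, -, hra⟩ := exists_radius hq hq1 ha
  have ha1 : ∀ m, ‖a m‖ < 1 := fun m => (ha m).trans_lt hq1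
  have hpos : 0 < 1 - ‖a m‖ ^ 2 := by
    have := pow_lt_one₀ (norm_nonneg _) (ha1 m) two_ne_zero
    linarith
  rw [takenaka, pair_C_mul_left, pair_C_mul_right,
    pair_partialProd_mul (convergesInDisc_szego (ha1 m)) hr
      (summableAt_szego (by linarith) (hra m)) ha1 hra, pair_szego_self (ha1 m),
    Complex.conj_ofReal, ← mul_assoc, ← Complex.ofReal_mul, Real.mul_self_sqrt hpos.le,
    mul_inv_cancel₀ (by exact_mod_cast hpos.ne')]

/-- This splits the kernel at `w` into its component along the kernel at `b` and a multiple of the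
Blaschke factor of `b`. The last coefficient is the conjugate of the value of that factor at `w`. -/
theorem szego_eq (b w : ℂ) (h : 1 - b * conj w ≠ 0) :
    szego w = C (((1 - ‖b‖ ^ 2 : ℝ) : ℂ) / (1 - b * conj w)) * szego b
      + C ((conj w - conj b) / (1 - b * conj w)) * (factor b * szego w) := by
  have key : (1 : PowerSeries ℂ) - C (conj b) * X
      = C (((1 - ‖b‖ ^ 2 : ℝ) : ℂ) / (1 - b * conj w)) * (1 - C (conj w) * X)
        + C ((conj w - conj b) / (1 - b * conj w)) * (X - C b) := by
    have e1 : (1 : ℂ) = ((1 - ‖b‖ ^ 2 : ℝ) : ℂ) / (1 - b * conj w)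
        - (conj w - conj b) / (1 - b * conj w) * b := by
      push_cast; rw [← Complex.conj_mul']; field_simp; ring
    have e2 : conj b = ((1 - ‖b‖ ^ 2 : ℝ) : ℂ) / (1 - b * conj w) * conj w
        - (conj w - conj b) / (1 - b * conj w) := by
      push_cast; rw [← Complex.conj_mul']; field_simp; ring
    have e1' := congrArg (C : ℂ →+* PowerSeries ℂ) e1
    have e2' := congrArg (C : ℂ →+* PowerSeries ℂ) e2
    simp only [map_sub, map_mul, map_one] at e1' e2'
    linear_combination e1' - X * e2'
  have hb := one_sub_mul_szego b
  have hw := one_sub_mul_szego w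
  rw [factor]
  linear_combination (szego b * szego w) * key - szego w * hb
    + C (((1 - ‖b‖ ^ 2 : ℝ) : ℂ) / (1 - b * conj w)) * szego b * hw

/-- If `f` is orthogonal to the Takenaka–Malmquist system, then `f(w)` is the product of the value
at `w` of a partial Blaschke product and the pairing of `f` with that product times the kernel. -/
theorem pair_szego_eq_prod_mul (hq : 0 ≤ q) (hq1 : q < 1) (ha : ∀ m, ‖a m‖ ≤ q)
    (hf : ConvergesInDisc f) (h0 : ∀ m, pair f (takenaka a m) = 0) {w : ℂ} (hw : ‖w‖ < 1) (m : ℕ) :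
    pair f (szego w) = (∏ i ∈ Finset.range m, (w - a i) / (1 - conj (a i) * w))
      * pair f (partialProd a m * szego w) := by
  have ha1 : ∀ m, ‖a m‖ < 1 := fun m => (ha m).trans_lt hq1
  obtain ⟨r, hr, hrq, hrw⟩ := exists_radius (a := fun _ => w) (q := max q ‖w‖)
    (hq.trans (le_max_left _ _)) (max_lt hq1 hw) (fun _ => le_max_right _ _)
  have hr0 : 0 ≤ r := by linarith
  have hra : ∀ m, r * ‖a m‖ < 1 := fun m =>
    (mul_le_mul_of_nonneg_left ((ha m).trans (le_max_left _ _)) hr0).trans_lt hrq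
  have hsw : SummableAt r (szego w) := summableAt_szego hr0 (hrw 0)
  induction m with
  | zero => simp [partialProd]
  | succ m ih =>
    have hne : 1 - a m * conj w ≠ 0 := by
      refine sub_ne_zero.2 fun h => ?_
      have h1 : ‖a m * conj w‖ < 1 := by
        rw [norm_mul, RCLike.norm_conj]
        nlinarith [ha1 m, norm_nonneg (a m), norm_nonneg w]
      rw [← h, norm_one] at h1
      exact lt_irrefl _ h1
    have hpos : 0 < 1 - ‖a m‖ ^ 2 := by
      have := pow_lt_one₀ (norm_nonneg _) (ha1 m) two_ne_zero
      linarith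
    have hsq : (C (√(1 - ‖a m‖ ^ 2) : ℂ) : PowerSeries ℂ) * C ((√(1 - ‖a m‖ ^ 2) : ℂ)⁻¹) = 1 := by
      rw [← map_mul, mul_inv_cancel₀ (by exact_mod_cast (Real.sqrt_pos.2 hpos).ne'), map_one]
    -- Splitting the kernel at `b = a m` produces a multiple of `takenaka a m`, which pairs to zero
    -- with `f`; the other term involves the next partial product.
    have e : partialProd a m * szego w = C (((1 - ‖a m‖ ^ 2 : ℝ) : ℂ) / (1 - a m * conj w)
        * (√(1 - ‖a m‖ ^ 2) : ℂ)⁻¹) * takenaka a m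
        + C ((conj w - conj (a m)) / (1 - a m * conj w)) * (partialProd a (m + 1) * szego w) := by
      conv_lhs => rw [szego_eq (a m) w hne]
      rw [takenaka, partialProd, partialProd, Finset.prod_range_succ, ← partialProd,
        map_mul]
      linear_combination (-C (((1 - ‖a m‖ ^ 2 : ℝ) : ℂ) / (1 - a m * conj w)))
        * partialProd a m * szego (a m) * hsq
    rw [ih, e, pair_add_right hf hr ((summableAt_C r _).mul hr0 (summableAt_takenaka hr0 hra m))
      ((summableAt_C r _).mul hr0 ((summableAt_partialProd hr0 hra _).mul hr0 hsw)),
      pair_C_mul_right, pair_C_mul_right, h0 m, mul_zero, zero_add, Finset.prod_range_succ,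
      map_div₀, map_sub, map_sub, map_mul, Complex.conj_conj, Complex.conj_conj, map_one]
    ring

/-- Near the origin a Blaschke factor is close in modulus to `‖b‖`, so partial products decay
geometrically there. This drives the completeness of the system. -/
theorem norm_factor_value_le (hq1 : q < 1) {b w : ℂ} (hb : ‖b‖ ≤ q) (hw : ‖w‖ ≤ (1 - q) / 4) :
    ‖(w - b) / (1 - conj b * w)‖ ≤ (1 + q) / 2 := by
  have hq : 0 ≤ q := (norm_nonneg b).trans hb
  have h1 : 1 - (1 - q) / 4 ≤ ‖1 - conj b * w‖ := by
    have h2 := norm_sub_norm_le (1 : ℂ) (conj b * w)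
    rw [norm_one, norm_mul, RCLike.norm_conj] at h2
    nlinarith [norm_nonneg w, norm_nonneg b]
  have hpos : 0 < ‖1 - conj b * w‖ := by linarith
  rw [norm_div, div_le_iff₀ hpos]
  have h3 : w - b = -b * (1 - conj b * w) + ((1 - ‖b‖ ^ 2 : ℝ) : ℂ) * w := by
    push_cast; rw [← Complex.conj_mul']; ring
  have h4 : ‖w - b‖ ≤ ‖b‖ * ‖1 - conj b * w‖ + ‖w‖ := by
    rw [h3]
    refine (norm_add_le _ _).trans ?_
    rw [norm_mul, norm_mul, norm_neg, Complex.norm_real, Real.norm_of_nonneg (by nlinarith [norm_nonneg b])]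
    nlinarith [norm_nonneg w, sq_nonneg ‖b‖]
  nlinarith

end TakenakaMalmquist

/-! ### Completeness of the system in `ℓ²` and exponential decay of its coefficients. -/

section Basis

open PowerSeries

/-- The Hilbert space `ℓ²(ℕ)`. -/
noncomputable abbrev L2 : Type := lp (fun _ : ℕ => ℂ) 2

theorem SummableAt.memℓp {f : PowerSeries ℂ} {r : ℝ} (hr : 1 ≤ r) (hf : SummableAt r f) :
    Memℓp (fun n => coeff n f) 2 := by
  have h1 : Memℓp (fun n => coeff n f) 1 := by
    refine memℓp_gen ?_
    simpa [SummableAt] using hf.mono zero_le_one hr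
  exact h1.of_exponent_ge one_le_two

theorem convergesInDisc_of_bounded {x : ℕ → ℂ} {B : ℝ} (h : ∀ n, ‖x n‖ ≤ B) :
    ConvergesInDisc (PowerSeries.mk x) := by
  intro r hr hr1
  refine Summable.of_nonneg_of_le (fun n => by positivity) (fun n => ?_)
    ((summable_geometric_of_lt_one hr hr1).mul_left B)
  rw [coeff_mk]
  gcongr
  exact h n

theorem convergesInDisc_mk (x : L2) : ConvergesInDisc (PowerSeries.mk x) :=
  convergesInDisc_of_bounded fun n => lp.norm_apply_le_norm two_ne_zero x n

theorem inner_eq_pair (x y : L2) : inner ℂ x y = pair (PowerSeries.mk y) (PowerSeries.mk x) := by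
  rw [lp.inner_eq_tsum, pair]
  exact tsum_congr fun n => by simp [coeff_mk]

/-- Pairing with `szego w` evaluates the series at `w`, and a power series that vanishes near `0`
has zero coefficients. -/
theorem eq_zero_of_pair_szego {x : L2} {δ : ℝ} (hδ : 0 < δ)
    (h : ∀ w : ℂ, ‖w‖ < δ → pair (PowerSeries.mk x) (szego w) = 0) : x = 0 := by
  have hx : HasFPowerSeriesAt (0 : ℂ → ℂ) (FormalMultilinearSeries.ofScalars ℂ (x : ℕ → ℂ)) 0 := by
    rw [hasFPowerSeriesAt_iff]
    filter_upwards [Metric.ball_mem_nhds (0 : ℂ) (lt_min hδ one_pos)] with w hw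
    rw [mem_ball_zero_iff, lt_min_iff] at hw
    have h1 := h w hw.1
    rw [pair_szego] at h1
    have h2 : Summable fun n => coeff n (PowerSeries.mk x) * w ^ n := by
      refine Summable.of_norm ((convergesInDisc_mk x ‖w‖ (norm_nonneg w) hw.2).congr fun n => ?_)
      rw [norm_mul, norm_pow]
    have h3 := h2.hasSum
    rw [h1] at h3
    refine h3.congr_fun fun n => ?_
    simp [mul_comm]
  have h0 := hx.eq_zero
  refine lp.ext (funext fun n => ?_)
  have h1 := congrArg (fun p => FormalMultilinearSeries.coeff p n) h0
  rw [FormalMultilinearSeries.coeff_ofScalars] at h1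
  exact h1

variable {a : ℕ → ℂ} {q : ℝ}

/-- The Takenaka–Malmquist system is a Hilbert basis of `ℓ²`. -/
theorem exists_hilbertBasis_takenaka (hq : 0 ≤ q) (hq1 : q < 1) (ha : ∀ m, ‖a m‖ ≤ q) :
    ∃ b : HilbertBasis ℕ ℂ L2, ∀ m n, b m n = coeff n (takenaka a m) := by
  obtain ⟨r, hr, hrq, hra⟩ := exists_radius hq hq1 ha
  have hr0 : 0 ≤ r := by linarith
  have ha1 : ∀ m, ‖a m‖ < 1 := fun m => (ha m).trans_lt hq1
  let v : ℕ → L2 := fun m => ⟨fun n => coeff n (takenaka a m),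
    (summableAt_takenaka hr0 hra m).memℓp hr.le⟩
  have hv : ∀ m, PowerSeries.mk (v m) = takenaka a m := fun m => by ext n; simp [v]
  have hort : Orthonormal ℂ v := by
    rw [orthonormal_iff_ite]
    intro i j
    rw [inner_eq_pair, hv, hv]
    split_ifs with hij
    · rw [hij, pair_takenaka_self hq hq1 ha]
    · rcases lt_or_gt_of_ne hij with h | h
      · exact pair_takenaka_of_lt hq hq1 ha h
      · rw [← pair_conj_symm, pair_takenaka_of_lt hq hq1 ha h, map_zero]
  have hspan : (Submodule.span ℂ (Set.range v))ᗮ = ⊥ := by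
    rw [eq_bot_iff]
    intro x hx
    have h0 : ∀ m, pair (PowerSeries.mk x) (takenaka a m) = 0 := fun m => by
      rw [← hv, ← inner_eq_pair]
      exact (Submodule.mem_orthogonal _ _).1 hx _ (Submodule.subset_span ⟨m, rfl⟩)
    refine (Submodule.mem_bot ℂ).2 (eq_zero_of_pair_szego (δ := (1 - q) / 4) (by linarith) ?_)
    intro w hw
    have hw1 : ‖w‖ < 1 := by linarith
    obtain ⟨s, hs, hsq, hsw⟩ := exists_radius (a := fun _ => w) (q := max q ‖w‖)
      (hq.trans (le_max_left _ _)) (max_lt hq1 hw1) (fun _ => le_max_right _ _)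
    have hs0 : 0 ≤ s := by linarith
    have hsa : ∀ m, s * ‖a m‖ < 1 := fun m =>
      (mul_le_mul_of_nonneg_left ((ha m).trans (le_max_left _ _)) hs0).trans_lt hsq
    have hsz : SummableAt s (szego w) := summableAt_szego hs0 (hsw 0)
    let y : ℕ → L2 := fun m => ⟨fun n => coeff n (partialProd a m * szego w),
      ((summableAt_partialProd hs0 hsa m).mul hs0 hsz).memℓp hs.le⟩
    have hy : ∀ m, PowerSeries.mk (y m) = partialProd a m * szego w := fun m => by
      ext n; simp [y]
    have hyn : ∀ m, ‖y m‖ = ‖y 0‖ := by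
      have h1 : ∀ m, inner ℂ (y m) (y m) = pair (szego w) (szego w) := fun m => by
        rw [inner_eq_pair, hy, pair_partialProd_mul (convergesInDisc_szego hw1) hs hsz ha1 hsa]
      intro m
      have h2 := (h1 m).trans (h1 0).symm
      rw [inner_self_eq_norm_sq_to_K, inner_self_eq_norm_sq_to_K] at h2
      exact (pow_left_inj₀ (norm_nonneg _) (norm_nonneg _) two_ne_zero).1 (by exact_mod_cast h2)
    -- The Blaschke values contribute at most `((1 + q) / 2) ^ m`, while the norms of `y m` do not
    -- depend on `m`; hence the pairing is zero.
    have hle : ∀ m : ℕ, ‖pair (PowerSeries.mk x) (szego w)‖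
        ≤ ((1 + q) / 2) ^ m * (‖y 0‖ * ‖x‖) := by
      intro m
      rw [pair_szego_eq_prod_mul hq hq1 ha (convergesInDisc_mk x) h0 hw1 m, norm_mul, norm_prod,
        ← hy, ← inner_eq_pair]
      gcongr
      · calc ∏ i ∈ Finset.range m, ‖(w - a i) / (1 - conj (a i) * w)‖
            ≤ ∏ i ∈ Finset.range m, (1 + q) / 2 :=
              Finset.prod_le_prod (fun _ _ => norm_nonneg _)
                fun i _ => norm_factor_value_le hq1 (ha i) hw.le
          _ = _ := by rw [Finset.prod_const, Finset.card_range]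
      · rw [← hyn m]
        exact norm_inner_le_norm _ _
    have hlim : Filter.Tendsto (fun m : ℕ => ((1 + q) / 2) ^ m * (‖y 0‖ * ‖x‖)) Filter.atTop
        (nhds (0 * (‖y 0‖ * ‖x‖))) :=
      (tendsto_pow_atTop_nhds_zero_of_lt_one (by linarith) (by linarith)).mul_const _
    rw [zero_mul] at hlim
    exact norm_le_zero_iff.1 (ge_of_tendsto' hlim hle)
  refine ⟨HilbertBasis.mkOfOrthogonalEqBot hort hspan, fun m n => ?_⟩
  rw [HilbertBasis.coe_mkOfOrthogonalEqBot]

/-- One estimate serves twice: a radius `r > 1` gives decay in `n`, and a small radius, for which `A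
< 1` is possible, gives decay in `m`. -/
theorem norm_coeff_takenaka_le {r A : ℝ} (hr : 0 < r) (hrq : r * q < 1)
    (ha : ∀ m, ‖a m‖ ≤ q) (hA : ∀ m, wienerNorm r (factor (a m)) ≤ A) (m n : ℕ) :
    ‖coeff n (takenaka a m)‖ ≤ (1 - r * q)⁻¹ * A ^ m * r⁻¹ ^ n := by
  have hra : ∀ m, r * ‖a m‖ < 1 := fun m =>
    (mul_le_mul_of_nonneg_left (ha m) hr.le).trans_lt hrq
  have h1 := norm_coeff_mul_pow_le hr.le (summableAt_takenaka hr.le hra m) n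
  have hs := (summableAt_partialProd hr.le hra m).mul hr.le (summableAt_szego hr.le (hra m))
  have h2 := wienerNorm_mul_le hr.le (summableAt_C r (√(1 - ‖a m‖ ^ 2) : ℂ)) hs
  have h3 := wienerNorm_mul_le hr.le (summableAt_partialProd hr.le hra m)
    (summableAt_szego hr.le (hra m))
  have h4 := wienerNorm_prod_le hr.le (Finset.range m)
    (fun i _ => summableAt_factor hr.le (hra i)) (fun i _ => hA i)
  rw [Finset.card_range, ← partialProd] at h4
  have h5 : wienerNorm r (szego (a m)) ≤ (1 - r * q)⁻¹ := by
    rw [wienerNorm_szego hr.le (hra m)]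
    have := ha m
    gcongr
  have h6 : wienerNorm r (C (√(1 - ‖a m‖ ^ 2) : ℂ)) ≤ 1 := by
    rw [wienerNorm_C, Complex.norm_real, Real.norm_of_nonneg (Real.sqrt_nonneg _)]
    exact Real.sqrt_le_one.2 (by nlinarith [norm_nonneg (a m)])
  have h7 := wienerNorm_nonneg hr.le (partialProd a m * szego (a m))
  have h8 : wienerNorm r (partialProd a m * szego (a m)) ≤ A ^ m * (1 - r * q)⁻¹ :=
    h3.trans (mul_le_mul h4 h5 (wienerNorm_nonneg hr.le _)
      ((wienerNorm_nonneg hr.le _).trans h4))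
  rw [inv_pow, ← div_eq_mul_inv, le_div_iff₀ (by positivity)]
  calc _ ≤ wienerNorm r (takenaka a m) := h1
    _ ≤ _ := h2
    _ ≤ 1 * wienerNorm r (partialProd a m * szego (a m)) := by gcongr
    _ ≤ _ := by rw [one_mul]; linarith

theorem wienerNorm_factor_le_of_le {r : ℝ} (hr : 0 < r) (hrq : r * q < 1) (hq1 : q < 1)
    (ha : ∀ m, ‖a m‖ ≤ q) (m : ℕ) : wienerNorm r (factor (a m)) ≤ q + r * (1 - r * q)⁻¹ := by
  have h := ha m
  refine (wienerNorm_factor_le hr.le ((mul_le_mul_of_nonneg_left h hr.le).trans_lt hrq)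
    (h.trans_lt hq1)).trans ?_
  gcongr

/-- The coefficients of the Takenaka–Malmquist functions decay exponentially in `n`. -/
theorem exists_coeff_takenaka_le (hq : 0 ≤ q) (hq1 : q < 1) (ha : ∀ m, ‖a m‖ ≤ q) :
    ∃ K A s : ℝ, 0 ≤ K ∧ 1 ≤ A ∧ 0 < s ∧ s < 1 ∧
      ∀ m n, ‖coeff n (takenaka a m)‖ ≤ K * A ^ m * s ^ n := by
  obtain ⟨r, hr, hrq, -⟩ := exists_radius hq hq1 ha
  have hr0 : 0 < r := by linarith
  have h0 : 0 < 1 - r * q := by linarith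
  refine ⟨_, _, _, (inv_pos.2 h0).le, ?_, inv_pos.2 hr0, inv_lt_one_of_one_lt₀ hr,
    norm_coeff_takenaka_le hr0 hrq ha
      (wienerNorm_factor_le_of_le hr0 hrq hq1 ha)⟩
  have h1 : 1 ≤ (1 - r * q)⁻¹ := (one_le_inv₀ h0).2 (by nlinarith)
  nlinarith

/-- The coefficients of the Takenaka–Malmquist functions decay exponentially in `m`. -/
theorem exists_coeff_takenaka_le' (hq : 0 ≤ q) (hq1 : q < 1) (ha : ∀ m, ‖a m‖ ≤ q) :
    ∃ K A s : ℝ, 0 ≤ K ∧ 1 ≤ A ∧ 0 < s ∧ s < 1 ∧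
      ∀ m n, ‖coeff n (takenaka a m)‖ ≤ K * A ^ n * s ^ m := by
  -- At this radius the factor norms are at most `q + (1 - q) / 4 * (4 / 3) ≤ (1 + q) / 2 < 1`.
  have hr0 : 0 < (1 - q) / 4 := by linarith
  have hrq : (1 - q) / 4 * q < 1 := by nlinarith
  have h0 : 0 < 1 - (1 - q) / 4 * q := by linarith
  have h1 : (1 - (1 - q) / 4 * q)⁻¹ ≤ 4 / 3 := by
    rw [inv_le_comm₀ h0 (by norm_num)]
    nlinarith
  refine ⟨(1 - (1 - q) / 4 * q)⁻¹, ((1 - q) / 4)⁻¹, (1 + q) / 2, (inv_pos.2 h0).le,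
    (one_le_inv₀ hr0).2 (by linarith), by linarith, by linarith, fun m n => ?_⟩
  have h := norm_coeff_takenaka_le hr0 hrq ha (A := (1 + q) / 2)
    (fun m => (wienerNorm_factor_le_of_le hr0 hrq hq1 ha m).trans (by nlinarith)) m n
  calc _ ≤ _ := h
    _ = _ := by ring

end Basis

end DirichletWandering

namespace DirichletWandering

/-! ### Weighted bounds for isometries with almost diagonal matrices. -/

section Weights

/-- The map `W` is bounded, with constant `C` for the squares, in the norm with weights
`(n + 1) ^ α`. -/
def WeightBounded (α C : ℝ) (W : L2 → L2) : Prop :=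
  ∀ (x : L2) (S : ℝ), (∀ M, ∑ n ∈ Finset.range M, weight α n * ‖x n‖ ^ 2 ≤ S) →
    ∀ M, ∑ n ∈ Finset.range M, weight α n * ‖W x n‖ ^ 2 ≤ C * S

theorem sum_norm_sq_le (x : L2) (s : Finset ℕ) : ∑ n ∈ s, ‖x n‖ ^ 2 ≤ ‖x‖ ^ 2 := by
  have h := lp.sum_rpow_le_norm_rpow (p := 2) (by simp) x s
  simpa using h

theorem hasSum_norm_sq (x : L2) : HasSum (fun n => ‖x n‖ ^ 2) (‖x‖ ^ 2) := by
  have h := lp.hasSum_norm (p := 2) (by simp) x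
  simpa using h

/-- The truncation of a sequence. -/
noncomputable def truncate (a : ℕ → ℂ) (k : ℕ) : L2 := ∑ m ∈ Finset.range k, lp.single 2 m (a m)

theorem truncate_apply (a : ℕ → ℂ) (k n : ℕ) : truncate a k n = if n < k then a n else 0 := by
  rw [truncate, lp.coeFn_sum, Finset.sum_apply]
  simp only [lp.single_apply, Pi.single_apply, Finset.sum_ite_eq, Finset.mem_range]

theorem norm_sub_truncate_sq (x : L2) (k : ℕ) :
    ‖x - truncate x k‖ ^ 2 = ‖x‖ ^ 2 - ∑ m ∈ Finset.range k, ‖x m‖ ^ 2 := by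
  have h := lp.norm_compl_sum_single (p := 2) (by simp) x (Finset.range k)
  simpa [truncate] using h

variable {W : L2 →ₗᵢ[ℂ] L2} {K A s : ℝ}

theorem norm_map_truncate_le (hK : 0 ≤ K) (hA : 1 ≤ A) (hs : 0 < s)
    (hW : ∀ m n, ‖W (lp.single 2 m 1) n‖ ≤ K * A ^ m * s ^ n) (x : L2) (k n : ℕ) :
    ‖W (truncate x k) n‖ ≤ K * ‖x‖ * (k * A ^ k * s ^ n) := by
  have h1 : ∀ m, W (lp.single 2 m (x m)) = x m • W (lp.single 2 m 1) := fun m => by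
    rw [← map_smul, ← lp.single_smul, smul_eq_mul, mul_one]
  rw [truncate, map_sum, lp.coeFn_sum, Finset.sum_apply]
  calc ‖∑ m ∈ Finset.range k, W (lp.single 2 m (x m)) n‖
      ≤ ∑ m ∈ Finset.range k, ‖W (lp.single 2 m (x m)) n‖ := norm_sum_le _ _
    _ ≤ ∑ m ∈ Finset.range k, ‖x‖ * (K * A ^ k * s ^ n) := by
        refine Finset.sum_le_sum fun m hm => ?_
        rw [h1, lp.coeFn_smul, Pi.smul_apply, norm_smul]
        have h2 := pow_le_pow_right₀ hA (Finset.mem_range.1 hm).le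
        exact mul_le_mul (lp.norm_apply_le_norm two_ne_zero x m)
          ((hW m n).trans (by gcongr)) (norm_nonneg _) (norm_nonneg _)
    _ = _ := by rw [Finset.sum_const, Finset.card_range, nsmul_eq_mul]; ring

/-- Beyond `n = P * k` the decay `s ^ n` beats the growth `A ^ k` of the first `k` columns, leaving
`k * (A * s ^ P) ^ k ≤ (1 / 2) ^ k`. -/
theorem sum_norm_map_truncate_sq_le (hK : 0 ≤ K) (hA : 1 ≤ A) (hs : 0 < s) (hs1 : s < 1)
    (hW : ∀ m n, ‖W (lp.single 2 m 1) n‖ ≤ K * A ^ m * s ^ n) {P : ℕ} (hP : A * s ^ P ≤ 1 / 4)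
    (x : L2) (k M : ℕ) :
    ∑ n ∈ Finset.range M with P * k ≤ n, ‖W (truncate x k) n‖ ^ 2
      ≤ K ^ 2 / (1 - s ^ 2) * (1 / 4) ^ k * ‖x‖ ^ 2 := by
  have hs2 : s ^ 2 < 1 := pow_lt_one₀ hs.le hs1 two_ne_zero
  have hgeom : ∑ n ∈ Finset.range M with P * k ≤ n, (s ^ 2) ^ n
      ≤ (s ^ 2) ^ (P * k) / (1 - s ^ 2) := by
    have h1 : HasSum (fun n => (s ^ 2) ^ (n + P * k)) ((s ^ 2) ^ (P * k) / (1 - s ^ 2)) := by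
      have := (hasSum_geometric_of_lt_one (sq_nonneg s) hs2).mul_left ((s ^ 2) ^ (P * k))
      refine this.congr_fun fun n => ?_
      rw [pow_add, mul_comm]
    have h2 : ∑ n ∈ Finset.range M with P * k ≤ n, (s ^ 2) ^ n
        ≤ ∑ n ∈ Finset.range M, (s ^ 2) ^ (n + P * k) := by
      rw [← Finset.sum_image (s := Finset.range M) (g := fun n => n + P * k)
        (f := fun n => (s ^ 2) ^ n) (fun a _ b _ h => Nat.add_right_cancel h)]
      refine Finset.sum_le_sum_of_subset_of_nonneg (fun n hn => ?_) fun _ _ _ => by positivity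
      rw [Finset.mem_filter, Finset.mem_range] at hn
      exact Finset.mem_image.2 ⟨n - P * k, Finset.mem_range.2 (by omega), by omega⟩
    exact h2.trans (sum_le_hasSum _ (fun _ _ => by positivity) h1)
  have hk : (k : ℝ) * (A * s ^ P) ^ k ≤ (1 / 2) ^ k := by
    have h1 : (k : ℝ) ≤ 2 ^ k := by exact_mod_cast Nat.lt_two_pow_self.le
    calc (k : ℝ) * (A * s ^ P) ^ k ≤ 2 ^ k * (1 / 4) ^ k := by gcongr
      _ = (1 / 2) ^ k := by rw [← mul_pow]; norm_num
  calc ∑ n ∈ Finset.range M with P * k ≤ n, ‖W (truncate x k) n‖ ^ 2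
      ≤ ∑ n ∈ Finset.range M with P * k ≤ n, (K * ‖x‖ * (k * A ^ k)) ^ 2 * (s ^ 2) ^ n := by
        refine Finset.sum_le_sum fun n _ => ?_
        refine (pow_le_pow_left₀ (norm_nonneg _)
          (norm_map_truncate_le hK hA hs hW x k n) 2).trans_eq ?_
        ring
    _ ≤ (K * ‖x‖ * (k * A ^ k)) ^ 2 * ((s ^ 2) ^ (P * k) / (1 - s ^ 2)) := by
        rw [← Finset.mul_sum]; gcongr
    _ = K ^ 2 / (1 - s ^ 2) * ((k : ℝ) * (A * s ^ P) ^ k) ^ 2 * ‖x‖ ^ 2 := by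
        rw [mul_pow A, ← pow_mul s P k, ← pow_mul s 2]; ring
    _ ≤ K ^ 2 / (1 - s ^ 2) * ((1 / 2) ^ k) ^ 2 * ‖x‖ ^ 2 := by
        have : 0 ≤ K ^ 2 / (1 - s ^ 2) := div_nonneg (sq_nonneg K) (by linarith)
        gcongr
    _ = _ := by rw [← pow_mul, mul_comm k 2, pow_mul]; norm_num

/-- Up to an exponentially small error, the tail of `W x` from `P * k` is controlled by the tail of
`x` from `k`: the truncation gives the error, and `W` is isometric on the remainder. -/
theorem sum_tail_norm_map_sq_le (hK : 0 ≤ K) (hA : 1 ≤ A) (hs : 0 < s) (hs1 : s < 1)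
    (hW : ∀ m n, ‖W (lp.single 2 m 1) n‖ ≤ K * A ^ m * s ^ n) {P : ℕ} (hP : A * s ^ P ≤ 1 / 4)
    (x : L2) (k M : ℕ) :
    ∑ n ∈ Finset.range M with P * k ≤ n, ‖W x n‖ ^ 2
      ≤ 2 * (K ^ 2 / (1 - s ^ 2) * (1 / 4) ^ k * ‖x‖ ^ 2)
        + 2 * (‖x‖ ^ 2 - ∑ m ∈ Finset.range k, ‖x m‖ ^ 2) := by
  have h1 := sum_norm_map_truncate_sq_le hK hA hs hs1 hW hP x k M
  have h2 := sum_norm_sq_le (W (x - truncate x k)) ({n ∈ Finset.range M | P * k ≤ n})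
  rw [W.norm_map, norm_sub_truncate_sq] at h2
  have h3 : ∀ n, ‖W x n‖ ^ 2 ≤ 2 * ‖W (truncate x k) n‖ ^ 2 + 2 * ‖W (x - truncate x k) n‖ ^ 2 := by
    intro n
    have e : W x n = W (truncate x k) n + W (x - truncate x k) n := by
      rw [← Pi.add_apply, ← lp.coeFn_add, ← map_add, add_sub_cancel]
    rw [e]
    have := norm_add_le (W (truncate x k) n) (W (x - truncate x k) n)
    nlinarith [norm_nonneg (W (truncate x k) n + W (x - truncate x k) n),
      sq_nonneg (‖W (truncate x k) n‖ - ‖W (x - truncate x k) n‖)]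
  refine (Finset.sum_le_sum fun n _ => h3 n).trans ?_
  rw [Finset.sum_add_distrib, ← Finset.mul_sum, ← Finset.mul_sum]
  linarith

theorem weight_eq_one_add_sum (α : ℝ) (j : ℕ) :
    weight α j = 1 + ∑ k ∈ Finset.range j, (weight α (k + 1) - weight α k) := by
  rw [Finset.sum_range_sub]
  simp [weight]

theorem weight_mono {α : ℝ} (hα : 0 ≤ α) : Monotone (weight α) := fun m n h => by
  rw [weight, weight]
  exact Real.rpow_le_rpow (by positivity) (by gcongr) hα

theorem weight_neg (α : ℝ) (n : ℕ) : weight (-α) n = (weight α n)⁻¹ :=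
  Real.rpow_neg (by positivity) α

theorem weight_succ_le {α : ℝ} (hα1 : α ≤ 1) (k : ℕ) : weight α (k + 1) ≤ 2 ^ (k + 1) := by
  have h1 : weight α (k + 1) ≤ ((k + 1 : ℕ) : ℝ) + 1 := by
    refine (Real.rpow_le_rpow_of_exponent_le ?_ hα1).trans_eq (Real.rpow_one _)
    push_cast; linarith [Nat.cast_nonneg (α := ℝ) k]
  have h2 : k + 1 + 1 ≤ 2 ^ (k + 1) := Nat.lt_two_pow_self
  exact h1.trans (by exact_mod_cast h2)

/-- An isometry of `ℓ²` whose matrix entries are exponentially small far away from the diagonal on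
one side is bounded for the weights `(n + 1) ^ α` with `0 ≤ α ≤ 1`. -/
theorem exists_weightBounded_of_nonneg (hK : 0 ≤ K) (hA : 1 ≤ A) (hs : 0 < s) (hs1 : s < 1)
    (hW : ∀ m n, ‖W (lp.single 2 m 1) n‖ ≤ K * A ^ m * s ^ n) {α : ℝ} (hα : 0 ≤ α)
    (hα1 : α ≤ 1) : ∃ C, 0 < C ∧ WeightBounded α C W := by
  obtain ⟨P₀, hP₀⟩ := exists_pow_lt_of_lt_one (show (0 : ℝ) < 1 / 4 / A by positivity) hs1
  rw [lt_div_iff₀ (by linarith), mul_comm] at hP₀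
  -- The successor keeps `P` positive, as division by `P` requires.
  let P := P₀ + 1
  have hP : A * s ^ P ≤ 1 / 4 := by
    refine le_trans ?_ hP₀.le
    gcongr A * ?_
    exact pow_le_pow_of_le_one hs.le hs1.le (Nat.le_succ _)
  have hP1 : 0 < P := Nat.succ_pos _
  set D := K ^ 2 / (1 - s ^ 2) with hD
  have hD0 : 0 ≤ D := div_nonneg (sq_nonneg K) (by nlinarith)
  refine ⟨(P : ℝ) ^ α * (3 + 2 * D), by positivity, fun x S hx M => ?_⟩
  let d : ℕ → ℝ := fun k => weight α (k + 1) - weight α k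
  have hd0 : ∀ k, 0 ≤ d k := fun k => sub_nonneg.2 (weight_mono hα k.le_succ)
  have hd1 : ∀ k, d k ≤ 2 ^ (k + 1) := fun k => by
    have := weight_succ_le hα1 k
    have h0 := (weight_pos α k).le
    simp only [d]; linarith
  have hxS : ‖x‖ ^ 2 ≤ S := by
    refine le_of_tendsto' (hasSum_norm_sq x).tendsto_sum_nat fun M =>
      (Finset.sum_le_sum fun n _ => ?_).trans (hx M)
    have h1 : 1 ≤ weight α n := by
      have := weight_mono hα n.zero_le
      simpa [weight] using this
    nlinarith [sq_nonneg ‖x n‖]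
  -- Exchanging the sums, `‖x m‖²` receives the sum of some `d k` with `k < m`, at most `weight α m
  -- - 1`.
  have htail : ∑ k ∈ Finset.range M, d k * (‖x‖ ^ 2 - ∑ m ∈ Finset.range (k + 1), ‖x m‖ ^ 2)
      ≤ S := by
    have h1 : ∀ k, HasSum (fun m => d k * if k < m then ‖x m‖ ^ 2 else 0)
        (d k * (‖x‖ ^ 2 - ∑ m ∈ Finset.range (k + 1), ‖x m‖ ^ 2)) := by
      intro k
      refine HasSum.mul_left _ ?_
      have h2 := (hasSum_nat_add_iff' (k + 1)).2 (hasSum_norm_sq x)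
      have h3 : HasSum (fun m => if k < m + (k + 1) then ‖x (m + (k + 1))‖ ^ 2 else 0)
          (‖x‖ ^ 2 - ∑ m ∈ Finset.range (k + 1), ‖x m‖ ^ 2
            - ∑ m ∈ Finset.range (k + 1), if k < m then ‖x m‖ ^ 2 else 0) := by
        rw [Finset.sum_eq_zero (s := Finset.range (k + 1))
          (f := fun m => if k < m then ‖x m‖ ^ 2 else 0), sub_zero]
        · refine h2.congr_fun fun m => ?_
          rw [if_pos (by omega)]
        · intro m hm
          rw [if_neg (by have := Finset.mem_range.1 hm; omega)]
      exact (hasSum_nat_add_iff' (k + 1)).1 h3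
    have h2 := hasSum_sum fun k (_ : k ∈ Finset.range M) => h1 k
    refine le_of_tendsto' h2.tendsto_sum_nat fun J => le_trans ?_ (hx J)
    refine Finset.sum_le_sum fun m _ => ?_
    have h3 : ∑ k ∈ Finset.range M, (d k * if k < m then ‖x m‖ ^ 2 else 0)
        = (∑ k ∈ Finset.range M with k < m, d k) * ‖x m‖ ^ 2 := by
      rw [Finset.sum_filter, Finset.sum_mul]
      exact Finset.sum_congr rfl fun k _ => by split_ifs <;> simp
    rw [h3]
    refine mul_le_mul_of_nonneg_right ?_ (sq_nonneg _)
    have h4 := weight_eq_one_add_sum α m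
    have h5 : ∑ k ∈ Finset.range M with k < m, d k ≤ ∑ k ∈ Finset.range m, d k := by
      refine Finset.sum_le_sum_of_subset_of_nonneg (fun k hk => ?_) fun k _ _ => hd0 k
      exact Finset.mem_range.2 (Finset.mem_filter.1 hk).2
    simp only [d] at h5 ⊢
    linarith
  -- The crude bound `d k ≤ 2 ^ (k + 1)` is beaten by the error factor `(1 / 4) ^ (k + 1)`.
  have hgeom : ∑ k ∈ Finset.range M, d k * (1 / 4) ^ (k + 1) ≤ 1 := by
    calc ∑ k ∈ Finset.range M, d k * (1 / 4) ^ (k + 1)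
        ≤ ∑ k ∈ Finset.range M, (1 / 2 : ℝ) * (1 / 2) ^ k := by
          refine Finset.sum_le_sum fun k _ => ?_
          calc d k * (1 / 4) ^ (k + 1) ≤ 2 ^ (k + 1) * (1 / 4) ^ (k + 1) := by
                gcongr; exact hd1 k
            _ = (1 / 2 : ℝ) * (1 / 2) ^ k := by rw [← mul_pow, ← pow_succ']; norm_num
      _ ≤ ∑' k, (1 / 2 : ℝ) * (1 / 2) ^ k := by
          refine Summable.sum_le_tsum _ (fun _ _ => by positivity) ?_
          exact (summable_geometric_of_lt_one (by norm_num) (by norm_num)).mul_left _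
      _ = 1 := by
          rw [tsum_mul_left, tsum_geometric_of_lt_one (by norm_num) (by norm_num)]; norm_num
  -- Summation by parts with the weight at `n / P` turns the sum into tails of `W x` from `P * (k +
  -- 1)`. The constant collects `1` from `‖W x‖²`, `2 * D` from the errors and `2` from the tails of
  -- `x`.
  have hmain : ∑ n ∈ Finset.range M, weight α (n / P) * ‖W x n‖ ^ 2 ≤ (3 + 2 * D) * S := by
    have h1 : ∀ n ∈ Finset.range M, weight α (n / P) * ‖W x n‖ ^ 2
        = ‖W x n‖ ^ 2 + ∑ k ∈ Finset.range M, d k * if P * (k + 1) ≤ n then ‖W x n‖ ^ 2 else 0 := by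
      intro n hn
      have h2 : Finset.range (n / P) = {k ∈ Finset.range M | P * (k + 1) ≤ n} := by
        ext k
        rw [Finset.mem_filter, Finset.mem_range, Finset.mem_range, Nat.lt_iff_add_one_le,
          Nat.le_div_iff_mul_le hP1, mul_comm]
        refine ⟨fun h => ⟨?_, h⟩, fun h => h.2⟩
        have := Nat.le_mul_of_pos_left (k + 1) hP1
        have := Finset.mem_range.1 hn
        omega
      rw [weight_eq_one_add_sum, h2, add_mul, one_mul, Finset.sum_filter, Finset.sum_mul]
      congr 1
      exact Finset.sum_congr rfl fun k _ => by split_ifs <;> simp [d]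
    rw [Finset.sum_congr rfl h1, Finset.sum_add_distrib, Finset.sum_comm]
    have h2 := sum_norm_sq_le (W x) (Finset.range M)
    rw [W.norm_map] at h2
    have h3 : ∑ k ∈ Finset.range M, ∑ n ∈ Finset.range M,
        (d k * if P * (k + 1) ≤ n then ‖W x n‖ ^ 2 else 0)
        ≤ 2 * D * ‖x‖ ^ 2 * ∑ k ∈ Finset.range M, d k * (1 / 4) ^ (k + 1)
          + 2 * ∑ k ∈ Finset.range M,
            d k * (‖x‖ ^ 2 - ∑ m ∈ Finset.range (k + 1), ‖x m‖ ^ 2) := by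
      rw [Finset.mul_sum, Finset.mul_sum, ← Finset.sum_add_distrib]
      refine Finset.sum_le_sum fun k _ => ?_
      rw [← Finset.mul_sum, ← Finset.sum_filter]
      refine (mul_le_mul_of_nonneg_left
        (sum_tail_norm_map_sq_le hK hA hs hs1 hW hP x (k + 1) M) (hd0 k)).trans_eq ?_
      ring
    have h4 : 2 * D * ‖x‖ ^ 2 * ∑ k ∈ Finset.range M, d k * (1 / 4) ^ (k + 1)
        ≤ 2 * D * ‖x‖ ^ 2 := mul_le_of_le_one_right (by positivity) hgeom
    have h5 : D * ‖x‖ ^ 2 ≤ D * S := mul_le_mul_of_nonneg_left hxS hD0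
    linarith
  calc ∑ n ∈ Finset.range M, weight α n * ‖W x n‖ ^ 2
      ≤ ∑ n ∈ Finset.range M, (P : ℝ) ^ α * (weight α (n / P) * ‖W x n‖ ^ 2) := by
        refine Finset.sum_le_sum fun n _ => ?_
        rw [← mul_assoc]
        gcongr
        rw [weight, weight, ← Real.mul_rpow (by positivity) (by positivity)]
        refine Real.rpow_le_rpow (by positivity) ?_ hα
        have h1 : n + 1 ≤ P * (n / P + 1) := Nat.lt_mul_div_succ n hP1
        exact_mod_cast h1
    _ ≤ (P : ℝ) ^ α * ((3 + 2 * D) * S) := by rw [← Finset.mul_sum]; gcongr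
    _ = _ := by ring

/-- Boundedness of the inverse for the weights `(n + 1) ^ (-α)` implies boundedness for the weights
`(n + 1) ^ α`. -/
theorem WeightBounded.of_symm_neg {W : L2 ≃ₗᵢ[ℂ] L2} {α C : ℝ} (hC : 0 < C)
    (h : WeightBounded (-α) C W.symm) : WeightBounded α C W := by
  intro x S hx M
  set y := W x with hy
  set Q := ∑ n ∈ Finset.range M, weight α n * ‖y n‖ ^ 2 with hQ
  -- This is the dual test vector: its norm for the inverse weights and its pairing with `W x` both
  -- give `Q`.
  let z : L2 := truncate (fun n => (weight α n : ℂ) * y n) M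
  have hw := weight_pos α
  have hz : ∀ J, ∑ n ∈ Finset.range J, weight (-α) n * ‖z n‖ ^ 2 ≤ Q := by
    intro J
    have h1 : ∀ n, weight (-α) n * ‖z n‖ ^ 2 = if n < M then weight α n * ‖y n‖ ^ 2 else 0 := by
      intro n
      rw [truncate_apply]
      split_ifs with hn
      · rw [norm_mul, Complex.norm_real, Real.norm_of_nonneg (hw n).le, weight_neg]
        have := (hw n).ne'
        field_simp
      · simp
    rw [Finset.sum_congr rfl fun n _ => h1 n, ← Finset.sum_filter]
    refine Finset.sum_le_sum_of_subset_of_nonneg (fun n hn => ?_)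
      fun n _ _ => mul_nonneg (hw n).le (sq_nonneg _)
    exact Finset.mem_range.2 (Finset.mem_filter.1 hn).2
  have hu := h z Q hz
  set v := W.symm z with hv
  have hinner : (Q : ℂ) = inner ℂ v x := by
    have h1 : inner ℂ v x = inner ℂ z y := by
      rw [hv, ← W.inner_map_map, W.apply_symm_apply]
    rw [h1]
    simp only [z, truncate]
    rw [sum_inner, hQ, Complex.ofReal_sum]
    refine Finset.sum_congr rfl fun n _ => ?_
    rw [lp.inner_single_left, RCLike.inner_apply, map_mul, Complex.conj_ofReal]
    push_cast
    rw [← Complex.conj_mul']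
    ring
  -- The arithmetic–geometric inequality is balanced by `C`, so that `Q ≤ (Q + C * S) / 2` and `Q`
  -- can be absorbed.
  have hle : ∀ J, ‖∑ n ∈ Finset.range J, inner ℂ (v n) (x n)‖ ≤ (Q + C * S) / 2 := by
    intro J
    have h2 : ∀ n, ‖inner ℂ (v n) (x n)‖
        ≤ 1 / (2 * C) * (weight (-α) n * ‖v n‖ ^ 2) + C / 2 * (weight α n * ‖x n‖ ^ 2) := by
      intro n
      refine (norm_inner_le_norm _ _).trans ?_
      rw [weight_neg]
      have hwn := hw n
      have e : 1 / (2 * C) * ((weight α n)⁻¹ * ‖v n‖ ^ 2) + C / 2 * (weight α n * ‖x n‖ ^ 2)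
          - ‖v n‖ * ‖x n‖ = (‖v n‖ - C * weight α n * ‖x n‖) ^ 2 / (2 * C * weight α n) := by
        field_simp
        ring
      have h3 : 0 ≤ (‖v n‖ - C * weight α n * ‖x n‖) ^ 2 / (2 * C * weight α n) := by positivity
      linarith
    refine (norm_sum_le _ _).trans ((Finset.sum_le_sum fun n _ => h2 n).trans ?_)
    rw [Finset.sum_add_distrib, ← Finset.mul_sum, ← Finset.mul_sum]
    calc _ ≤ 1 / (2 * C) * (C * Q) + C / 2 * S := by gcongr; exacts [hu J, hx J]
      _ = _ := by field_simp
  have hfin := le_of_tendsto' (lp.hasSum_inner v x).tendsto_sum_nat.norm hle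
  rw [← hinner, Complex.norm_real] at hfin
  have := le_abs_self Q
  rw [Real.norm_eq_abs] at hfin
  linarith

/-- An isometric isomorphism of `ℓ²` whose matrix entries are exponentially small far away from the
diagonal is bounded for the weights `(n + 1) ^ α` with `|α| ≤ 1`. -/
theorem exists_weightBounded {W : L2 ≃ₗᵢ[ℂ] L2} {K A s K' A' s' : ℝ}
    (hK : 0 ≤ K) (hA : 1 ≤ A) (hs : 0 < s) (hs1 : s < 1)
    (hW : ∀ m n, ‖W (lp.single 2 m 1) n‖ ≤ K * A ^ m * s ^ n)
    (hK' : 0 ≤ K') (hA' : 1 ≤ A') (hs' : 0 < s') (hs1' : s' < 1)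
    (hW' : ∀ m n, ‖W.symm (lp.single 2 m 1) n‖ ≤ K' * A' ^ m * s' ^ n)
    {α : ℝ} (hα : α ∈ Set.Icc (-1 : ℝ) 1) : ∃ C, 0 < C ∧ WeightBounded α C W := by
  rcases le_or_gt 0 α with h | h
  · exact exists_weightBounded_of_nonneg (W := W.toLinearIsometry) hK hA hs hs1 hW h hα.2
  · obtain ⟨C, hC, hb⟩ := exists_weightBounded_of_nonneg (W := W.symm.toLinearIsometry)
      hK' hA' hs' hs1' hW' (α := -α) (by linarith) (by linarith [hα.1])
    exact ⟨C, hC, hb.of_symm_neg hC⟩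

end Weights

/-! ### Extension to weighted sequences outside `ℓ²`. -/

section Sequences

variable {W : L2 ≃ₗᵢ[ℂ] L2} {α C S : ℝ}

/-- A weighted bound passes to coordinatewise limits. -/
theorem WeightBounded.of_tendsto {W : L2 → L2} (hW : WeightBounded α C W) {x : ℕ → L2} {y : ℕ → ℂ}
    (hy : ∀ m, Filter.Tendsto (fun J => W (x J) m) Filter.atTop (nhds (y m)))
    (hx : ∀ᶠ J in Filter.atTop, ∀ M, ∑ n ∈ Finset.range M, weight α n * ‖x J n‖ ^ 2 ≤ S) (M : ℕ) :
    ∑ m ∈ Finset.range M, weight α m * ‖y m‖ ^ 2 ≤ C * S := by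
  have h := tendsto_finsetSum (Finset.range M) fun m (_ : m ∈ Finset.range M) =>
    ((hy m).norm.pow 2).const_mul (weight α m)
  exact le_of_tendsto h (hx.mono fun J hJ => hW (x J) S hJ M)

theorem sum_truncate_le {a : ℕ → ℂ} (hS : HasSum (fun n => weight α n * ‖a n‖ ^ 2) S) (J M : ℕ) :
    ∑ n ∈ Finset.range M, weight α n * ‖truncate a J n‖ ^ 2 ≤ S := by
  refine le_trans (Finset.sum_le_sum fun n _ => ?_)
    (sum_le_hasSum (Finset.range M) (fun n _ => mul_nonneg (weight_pos α n).le (sq_nonneg _)) hS)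
  rw [truncate_apply]
  have := (weight_pos α n).le
  split_ifs
  · exact le_rfl
  · simpa using mul_nonneg this (sq_nonneg _)

theorem sum_truncate_sub_truncate_le {a : ℕ → ℂ}
    (hS : HasSum (fun n => weight α n * ‖a n‖ ^ 2) S) {I J : ℕ} (hIJ : I ≤ J) (M : ℕ) :
    ∑ n ∈ Finset.range M, weight α n * ‖(truncate a J - truncate a I) n‖ ^ 2
      ≤ S - ∑ n ∈ Finset.range I, weight α n * ‖a n‖ ^ 2 := by
  have hw := fun n => (weight_pos α n).le
  have h1 := sum_le_hasSum (Finset.range (max I M)) (fun n _ =>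
    mul_nonneg (hw n) (sq_nonneg ‖a n‖)) hS
  have h2 : ∑ n ∈ Finset.range M, weight α n * ‖(truncate a J - truncate a I) n‖ ^ 2
      ≤ ∑ n ∈ Finset.range (max I M) \ Finset.range I, weight α n * ‖a n‖ ^ 2 := by
    have h3 : ∀ n, weight α n * ‖(truncate a J - truncate a I) n‖ ^ 2
        ≤ if ¬ n < I then weight α n * ‖a n‖ ^ 2 else 0 := by
      intro n
      rw [lp.coeFn_sub, Pi.sub_apply, truncate_apply, truncate_apply]
      have := mul_nonneg (hw n) (sq_nonneg ‖a n‖)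
      split_ifs <;> first | omega | (simp; done) | simpa using this
    refine (Finset.sum_le_sum fun n _ => h3 n).trans ?_
    rw [← Finset.sum_filter]
    refine Finset.sum_le_sum_of_subset_of_nonneg (fun n hn => ?_)
      fun n _ _ => mul_nonneg (hw n) (sq_nonneg _)
    rw [Finset.mem_filter, Finset.mem_range] at hn
    exact Finset.mem_sdiff.2 ⟨Finset.mem_range.2 (hn.1.trans_le (le_max_right _ _)),
      fun h => hn.2 (Finset.mem_range.1 h)⟩
  have h4 := Finset.sum_sdiff (f := fun n => weight α n * ‖a n‖ ^ 2)
    (Finset.range_mono (le_max_left I M))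
  linarith

/-- If `y` is the image of the weighted sequence `a` under `W`, in the sense of coordinatewise
limits of truncations, then the weighted norms of `a` and `y` are comparable. -/
theorem weighted_bounds {C' : ℝ} (hW : WeightBounded α C W)
    (hW' : WeightBounded α C' W.symm) {a y : ℕ → ℂ}
    (hS : HasSum (fun n => weight α n * ‖a n‖ ^ 2) S)
    (hy : ∀ m, Filter.Tendsto (fun J => W (truncate a J) m) Filter.atTop (nhds (y m))) :
    Summable (fun m => weight α m * ‖y m‖ ^ 2) ∧
      ∑' m, weight α m * ‖y m‖ ^ 2 ≤ C * S ∧ S ≤ 2 * C' * ∑' m, weight α m * ‖y m‖ ^ 2 := by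
  have hw := fun n => (weight_pos α n).le
  have hup := hW.of_tendsto hy (.of_forall fun J => sum_truncate_le hS J)
  have hsum : Summable (fun m => weight α m * ‖y m‖ ^ 2) :=
    summable_of_sum_range_le (fun m => mul_nonneg (hw m) (sq_nonneg _)) hup
  refine ⟨hsum, hsum.tsum_le_of_sum_range_le hup, ?_⟩
  set R := ∑' m, weight α m * ‖y m‖ ^ 2 with hR
  -- `t I` is the weighted tail of `a`; it bounds the distance from `y` to the image of a
  -- truncation. The inverse is applied to that image, which lies in `ℓ²`, before `I` tends to
  -- infinity.
  let t : ℕ → ℝ := fun I => S - ∑ n ∈ Finset.range I, weight α n * ‖a n‖ ^ 2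
  have hdiff : ∀ I M, ∑ m ∈ Finset.range M, weight α m * ‖y m - W (truncate a I) m‖ ^ 2
      ≤ C * t I := by
    intro I M
    refine hW.of_tendsto (x := fun J => truncate a J - truncate a I) (fun m => ?_)
      (Filter.eventually_atTop.2 ⟨I, fun J hJ => sum_truncate_sub_truncate_le hS hJ⟩) M
    simp only [map_sub, lp.coeFn_sub, Pi.sub_apply]
    exact (hy m).sub_const _
  have himg : ∀ I M, ∑ m ∈ Finset.range M, weight α m * ‖W (truncate a I) m‖ ^ 2
      ≤ 2 * R + 2 * (C * t I) := by
    intro I M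
    have h1 : ∀ m, weight α m * ‖W (truncate a I) m‖ ^ 2
        ≤ 2 * (weight α m * ‖y m‖ ^ 2) + 2 * (weight α m * ‖y m - W (truncate a I) m‖ ^ 2) := by
      intro m
      have h2 := norm_sub_le (y m) (y m - W (truncate a I) m)
      rw [sub_sub_cancel] at h2
      have h3 : ‖W (truncate a I) m‖ ^ 2 ≤ 2 * ‖y m‖ ^ 2 + 2 * ‖y m - W (truncate a I) m‖ ^ 2 := by
        nlinarith [norm_nonneg (W (truncate a I) m),
          sq_nonneg (‖y m‖ - ‖y m - W (truncate a I) m‖)]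
      nlinarith [mul_le_mul_of_nonneg_left h3 (hw m)]
    refine (Finset.sum_le_sum fun m _ => h1 m).trans ?_
    rw [Finset.sum_add_distrib, ← Finset.mul_sum, ← Finset.mul_sum]
    have h4 := hsum.sum_le_tsum (Finset.range M) fun m _ => mul_nonneg (hw m) (sq_nonneg _)
    have h5 := hdiff I M
    linarith
  have hback : ∀ I, ∑ n ∈ Finset.range I, weight α n * ‖a n‖ ^ 2
      ≤ C' * (2 * R + 2 * (C * t I)) := by
    intro I
    have h1 := hW' (W (truncate a I)) _ (himg I) I
    rw [W.symm_apply_apply] at h1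
    refine (Finset.sum_le_sum fun n hn => ?_).trans h1
    rw [truncate_apply, if_pos (Finset.mem_range.1 hn)]
  have ht : Filter.Tendsto t Filter.atTop (nhds 0) := by
    have := (tendsto_const_nhds (x := S)).sub hS.tendsto_sum_nat
    rwa [sub_self] at this
  have hlim : Filter.Tendsto (fun I => C' * (2 * R + 2 * (C * t I))) Filter.atTop
      (nhds (C' * (2 * R + 2 * (C * 0)))) :=
    (((ht.const_mul C).const_mul 2).const_add (2 * R)).const_mul C'
  have := le_of_tendsto_of_tendsto' hS.tendsto_sum_nat hlim hback
  linarith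

end Sequences

end DirichletWandering

namespace DirichletWandering

/-! ### Values of power series in the disc. -/

section Evaluation

open PowerSeries

/-- The sum of a power series at a point. -/
noncomputable def evalSeries (F : PowerSeries ℂ) (z : ℂ) : ℂ := ∑' n, coeff n F * z ^ n

variable {F G : PowerSeries ℂ} {z : ℂ}

theorem ConvergesInDisc.summable_norm (hF : ConvergesInDisc F) (hz : ‖z‖ < 1) :
    Summable fun n => ‖coeff n F * z ^ n‖ :=
  (hF ‖z‖ (norm_nonneg z) hz).congr fun n => by rw [norm_mul, norm_pow]

theorem ConvergesInDisc.hasSum (hF : ConvergesInDisc F) (hz : ‖z‖ < 1) :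
    HasSum (fun n => coeff n F * z ^ n) (evalSeries F z) :=
  (hF.summable_norm hz).of_norm.hasSum

theorem evalSeries_mul (hF : ConvergesInDisc F) (hG : ConvergesInDisc G) (hz : ‖z‖ < 1) :
    evalSeries (F * G) z = evalSeries F z * evalSeries G z := by
  rw [evalSeries, evalSeries, evalSeries, tsum_mul_tsum_eq_tsum_sum_antidiagonal_of_summable_norm
    (hF.summable_norm hz) (hG.summable_norm hz)]
  refine tsum_congr fun n => ?_
  rw [coeff_mul, Finset.sum_mul]
  refine Finset.sum_congr rfl fun p hp => ?_
  rw [← Finset.HasAntidiagonal.mem_antidiagonal.1 hp, pow_add]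
  ring

theorem evalSeries_C (c z : ℂ) : evalSeries (C c) z = c := by
  rw [evalSeries, tsum_eq_single 0 fun n hn => by simp [coeff_C, hn]]
  simp

theorem evalSeries_X (z : ℂ) : evalSeries X z = z := by
  rw [evalSeries, tsum_eq_single 1 fun n hn => by simp [coeff_X, hn]]
  simp

theorem convergesInDisc_C (c : ℂ) : ConvergesInDisc (C c) := fun r _ _ => summableAt_C r c

theorem convergesInDisc_X : ConvergesInDisc X := fun r _ _ => summableAt_X r

theorem convergesInDisc_factor {a : ℂ} (ha : ‖a‖ < 1) : ConvergesInDisc (factor a) :=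
  fun r hr hr1 => summableAt_factor hr (by nlinarith [norm_nonneg a])

theorem evalSeries_szego {a : ℂ} (ha : ‖a‖ < 1) (hz : ‖z‖ < 1) :
    evalSeries (szego a) z = (1 - conj a * z)⁻¹ := by
  have h : ‖conj a * z‖ < 1 := by
    rw [norm_mul, RCLike.norm_conj]
    nlinarith [norm_nonneg a, norm_nonneg z]
  rw [← tsum_geometric_of_norm_lt_one h]
  exact tsum_congr fun n => by rw [coeff_szego, mul_pow]

theorem evalSeries_factor {a : ℂ} (ha : ‖a‖ < 1) (hz : ‖z‖ < 1) :
    evalSeries (factor a) z = (z - a) / (1 - conj a * z) := by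
  have h1 : evalSeries (X - C a) z = z - a := by
    have h2 := (convergesInDisc_X.hasSum hz).sub ((convergesInDisc_C a).hasSum hz)
    rw [evalSeries_X, evalSeries_C] at h2
    rw [← h2.tsum_eq]
    exact tsum_congr fun n => by rw [map_sub, sub_mul]
  have hc : ConvergesInDisc (X - C a) := by
    rw [sub_eq_add_neg, ← map_neg]
    exact fun r hr hr1 => (summableAt_X r).add (summableAt_C r _) hr
  rw [factor, evalSeries_mul hc (convergesInDisc_szego ha) hz, h1, evalSeries_szego ha hz,
    div_eq_mul_inv]

theorem evalSeries_prod_factor {a : ℕ → ℂ} (ha : ∀ i, ‖a i‖ < 1) (hz : ‖z‖ < 1) (N : ℕ) :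
    evalSeries (partialProd a N) z = ∏ i ∈ Finset.range N, (z - a i) / (1 - conj (a i) * z) := by
  induction N with
  | zero => simpa [partialProd] using evalSeries_C 1 z
  | succ N ih =>
    rw [partialProd, Finset.prod_range_succ, ← partialProd, Finset.prod_range_succ,
      evalSeries_mul (F := partialProd a N) (convergesInDisc_prod ha (Finset.range N))
        (convergesInDisc_factor (ha N)) hz,
      ih, evalSeries_factor (ha N) hz]

end Evaluation

/-! ### Analytic functions on the disc and their Taylor series. -/

section TaylorSeries

open PowerSeries

/-- The Taylor series at the origin. -/
noncomputable def taylorSeries (f : 𝔻 → ℂ) : PowerSeries ℂ := PowerSeries.mk (taylorCoeff f)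

variable {f g : 𝔻 → ℂ}

theorem IsAnalytic.convergesInDisc (hf : IsAnalytic f) : ConvergesInDisc (taylorSeries f) := by
  intro r hr hr1
  have h := hf.hasSum (Complex.UnitDisc.mk (r : ℂ) (by
    rwa [Complex.norm_real, Real.norm_of_nonneg hr]))
  refine h.summable.norm.congr fun n => ?_
  rw [norm_mul, norm_pow, Complex.UnitDisc.coe_mk, Complex.norm_real, Real.norm_of_nonneg hr,
    taylorSeries, coeff_mk]

theorem IsAnalytic.eq_evalSeries (hf : IsAnalytic f) (z : 𝔻) :
    f z = evalSeries (taylorSeries f) z := by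
  rw [← (hf.hasSum z).tsum_eq, evalSeries]
  exact tsum_congr fun n => by rw [taylorSeries, coeff_mk]

theorem hasFPowerSeriesOnBall_extend {F : PowerSeries ℂ} (hF : ConvergesInDisc F)
    (h : ∀ z : 𝔻, f z = evalSeries F z) :
    HasFPowerSeriesOnBall (extend f)
      (FormalMultilinearSeries.ofScalars ℂ fun n => coeff n F) 0 1 := by
  refine ⟨?_, one_pos, ?_⟩
  · refine ENNReal.le_of_forall_nnreal_lt fun r hr => ?_
    refine FormalMultilinearSeries.le_radius_of_summable _ ?_
    refine (hF r r.2 (by exact_mod_cast hr)).congr fun n => ?_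
    rw [FormalMultilinearSeries.ofScalars_norm]
  · intro z hz
    have hz1 : ‖z‖ < 1 := by
      rw [Metric.mem_eball, edist_zero_right] at hz
      rw [← ENNReal.toReal_one, ← toReal_enorm]
      exact (ENNReal.toReal_lt_toReal hz.ne_top ENNReal.one_ne_top).2 hz
    have h1 : extend f (0 + z) = evalSeries F z := by
      rw [zero_add]
      have h2 := h (Complex.UnitDisc.mk z hz1)
      rwa [← extend_coe f, Complex.UnitDisc.coe_mk] at h2
    rw [h1]
    refine (hF.hasSum hz1).congr_fun fun n => ?_
    simp [mul_comm]

theorem isAnalytic_of_eq_evalSeries {F : PowerSeries ℂ} (hF : ConvergesInDisc F)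
    (h : ∀ z : 𝔻, f z = evalSeries F z) : IsAnalytic f := by
  have h1 := (hasFPowerSeriesOnBall_extend hF h).differentiableOn
  rwa [← ENNReal.ofReal_one, Metric.eball_ofReal] at h1

theorem taylorSeries_of_eq_evalSeries {F : PowerSeries ℂ} (hF : ConvergesInDisc F)
    (h : ∀ z : 𝔻, f z = evalSeries F z) : taylorSeries f = F := by
  have hf := isAnalytic_of_eq_evalSeries hF h
  have h1 := (hasFPowerSeriesOnBall_extend hF h).hasFPowerSeriesAt
  have h2 := (hasFPowerSeriesOnBall_extend hf.convergesInDisc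
    hf.eq_evalSeries).hasFPowerSeriesAt
  ext n
  have h3 := congrArg (fun p => FormalMultilinearSeries.coeff p n)
    (h2.eq_formalMultilinearSeries h1)
  rw [FormalMultilinearSeries.coeff_ofScalars, FormalMultilinearSeries.coeff_ofScalars] at h3
  exact h3

theorem mul_eq_evalSeries (hf : IsAnalytic f) (hg : IsAnalytic g) (z : 𝔻) :
    (f * g) z = evalSeries (taylorSeries f * taylorSeries g) z := by
  rw [evalSeries_mul hf.convergesInDisc hg.convergesInDisc z.norm_lt_one, ← hf.eq_evalSeries,
    ← hg.eq_evalSeries, Pi.mul_apply]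

theorem IsAnalytic.mul (hf : IsAnalytic f) (hg : IsAnalytic g) : IsAnalytic (f * g) :=
  isAnalytic_of_eq_evalSeries (hf.convergesInDisc.mul hg.convergesInDisc) (mul_eq_evalSeries hf hg)

theorem taylorSeries_mul (hf : IsAnalytic f) (hg : IsAnalytic g) :
    taylorSeries (f * g) = taylorSeries f * taylorSeries g :=
  taylorSeries_of_eq_evalSeries (hf.convergesInDisc.mul hg.convergesInDisc)
    (mul_eq_evalSeries hf hg)

theorem coeff_taylorSeries (f : 𝔻 → ℂ) (n : ℕ) : coeff n (taylorSeries f) = taylorCoeff f n :=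
  coeff_mk _ _

theorem taylorSeries_add (hf : IsAnalytic f) (hg : IsAnalytic g) :
    taylorSeries (f + g) = taylorSeries f + taylorSeries g := by
  ext n
  simp only [map_add, coeff_taylorSeries, taylorCoeff_add hf hg]

theorem taylorSeries_smul (c : ℂ) (f : 𝔻 → ℂ) :
    taylorSeries (c • f) = C c * taylorSeries f := by
  ext n
  rw [coeff_C_mul, coeff_taylorSeries, coeff_taylorSeries, taylorCoeff_smul]

end TaylorSeries

/-! ### Multipliers of `D_α`. -/

section Multiplier

open PowerSeries

theorem weight_add_le {α : ℝ} (hα : α ∈ Set.Icc (-1 : ℝ) 1) (i j : ℕ) :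
    weight α (i + j) ≤ (i + 1) * weight α j := by
  have hi : (1 : ℝ) ≤ (i : ℝ) + 1 := by linarith [Nat.cast_nonneg (α := ℝ) i]
  rcases le_or_gt 0 α with h | h
  · calc weight α (i + j) ≤ (((i : ℝ) + 1) * ((j : ℝ) + 1)) ^ α := by
          refine Real.rpow_le_rpow (by positivity) ?_ h
          push_cast
          nlinarith [mul_nonneg (Nat.cast_nonneg (α := ℝ) i) (Nat.cast_nonneg (α := ℝ) j)]
      _ = ((i : ℝ) + 1) ^ α * weight α j := Real.mul_rpow (by positivity) (by positivity)
      _ ≤ (i + 1) * weight α j := by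
          refine mul_le_mul_of_nonneg_right ?_ (weight_pos α j).le
          exact (Real.rpow_le_rpow_of_exponent_le hi hα.2).trans_eq (Real.rpow_one _)
  · have h1 : weight α (i + j) ≤ weight α j :=
      Real.rpow_le_rpow_of_nonpos (by positivity) (by push_cast; linarith) h.le
    nlinarith [weight_pos α j]

theorem summable_succ_mul_norm_coeff {r : ℝ} (hr : 1 < r) {U : PowerSeries ℂ}
    (hU : SummableAt r U) : Summable fun i : ℕ => ((i : ℝ) + 1) * ‖coeff i U‖ := by
  have hr1 : 0 < r - 1 := by linarith
  refine Summable.of_nonneg_of_le (fun i => by positivity) (fun i => ?_)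
    (Summable.mul_left (1 / (r - 1) + 1) hU)
  have h1 := one_add_mul_le_pow (show -2 ≤ r - 1 by linarith) i
  rw [add_sub_cancel] at h1
  have h2 : (i : ℝ) + 1 ≤ (1 / (r - 1) + 1) * r ^ i := by
    have h3 : (i : ℝ) ≤ 1 / (r - 1) * r ^ i := by
      rw [one_div, inv_mul_eq_div, le_div_iff₀ hr1]; linarith
    linarith [one_le_pow₀ hr.le (n := i)]
  calc ((i : ℝ) + 1) * ‖coeff i U‖ ≤ (1 / (r - 1) + 1) * r ^ i * ‖coeff i U‖ := by gcongr
    _ = _ := by ring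

/-- Functions that are analytic in a neighbourhood of the closed disc are multipliers. -/
theorem isMultiplier_of_summableAt {α r : ℝ} (hα : α ∈ Set.Icc (-1 : ℝ) 1) (hr : 1 < r)
    {u : 𝔻 → ℂ} (hu : IsAnalytic u) (hU : SummableAt r (taylorSeries u)) : IsMultiplier α u := by
  intro f hf
  refine ⟨hu.mul hf.1, ?_⟩
  have hs := summable_succ_mul_norm_coeff hr hU
  have hU1 : Summable fun i => ‖coeff i (taylorSeries u)‖ := by
    simpa [SummableAt] using hU.mono zero_le_one hr.le
  have hprod := (summable_norm_sum_mul_antidiagonal_of_summable_norm hs.norm hf.2.norm).of_norm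
  refine Summable.of_nonneg_of_le (fun n => mul_nonneg (sq_nonneg _) (weight_pos α n).le)
    (fun n => ?_) (hprod.mul_left (∑' i, ‖coeff i (taylorSeries u)‖))
  have h1 : ‖taylorCoeff (u * f) n‖ ≤ ∑ p ∈ Finset.HasAntidiagonal.antidiagonal n,
      ‖coeff p.1 (taylorSeries u)‖ * ‖taylorCoeff f p.2‖ := by
    rw [← coeff_taylorSeries, taylorSeries_mul hu hf.1, coeff_mul]
    refine (norm_sum_le _ _).trans_eq (Finset.sum_congr rfl fun p _ => ?_)
    rw [norm_mul, coeff_taylorSeries f]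
  -- By Cauchy–Schwarz with weights `‖u_i‖`, the weighted sum is dominated by the convolution of `(i
  -- + 1)‖u_i‖` with the terms of the norm of `f`.
  have h2 : (∑ p ∈ Finset.HasAntidiagonal.antidiagonal n,
      ‖coeff p.1 (taylorSeries u)‖ * ‖taylorCoeff f p.2‖) ^ 2
      ≤ (∑ p ∈ Finset.HasAntidiagonal.antidiagonal n, ‖coeff p.1 (taylorSeries u)‖) *
        ∑ p ∈ Finset.HasAntidiagonal.antidiagonal n,
          ‖coeff p.1 (taylorSeries u)‖ * ‖taylorCoeff f p.2‖ ^ 2 := by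
    refine Finset.sum_sq_le_sum_mul_sum_of_sq_le_mul _ (fun _ _ => norm_nonneg _)
      (fun _ _ => by positivity) fun p _ => le_of_eq ?_
    ring
  have h3 : ∑ p ∈ Finset.HasAntidiagonal.antidiagonal n, ‖coeff p.1 (taylorSeries u)‖
      ≤ ∑' i, ‖coeff i (taylorSeries u)‖ := by
    rw [Finset.Nat.sum_antidiagonal_eq_sum_range_succ_mk]
    exact hU1.sum_le_tsum _ fun _ _ => norm_nonneg _
  calc ‖taylorCoeff (u * f) n‖ ^ 2 * weight α n
      ≤ ((∑' i, ‖coeff i (taylorSeries u)‖) * ∑ p ∈ Finset.HasAntidiagonal.antidiagonal n,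
          ‖coeff p.1 (taylorSeries u)‖ * ‖taylorCoeff f p.2‖ ^ 2) * weight α n := by
        refine mul_le_mul_of_nonneg_right ?_ (weight_pos α n).le
        refine (pow_le_pow_left₀ (norm_nonneg _) h1 2).trans (h2.trans ?_)
        exact mul_le_mul_of_nonneg_right h3 (Finset.sum_nonneg fun _ _ => by positivity)
    _ = (∑' i, ‖coeff i (taylorSeries u)‖) * ∑ p ∈ Finset.HasAntidiagonal.antidiagonal n,
          ‖coeff p.1 (taylorSeries u)‖ * ‖taylorCoeff f p.2‖ ^ 2 * weight α n := by
        rw [mul_assoc, Finset.sum_mul]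
    _ ≤ _ := by
        refine mul_le_mul_of_nonneg_left (Finset.sum_le_sum fun p hp => ?_)
          (tsum_nonneg fun _ => norm_nonneg _)
        rw [← Finset.HasAntidiagonal.mem_antidiagonal.1 hp]
        have h4 := weight_add_le hα p.1 p.2
        have h5 : 0 ≤ ‖coeff p.1 (taylorSeries u)‖ * ‖taylorCoeff f p.2‖ ^ 2 := by positivity
        nlinarith [mul_le_mul_of_nonneg_left h4 h5]

end Multiplier

/-! ### Identification of `D_α` with `ℓ²`, and completeness. -/

section Completeness

open PowerSeries

variable {α : ℝ}

theorem memℓp_weighted (f : D α) :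
    Memℓp (fun n => (√(weight α n) : ℂ) * taylorCoeff f n) 2 := by
  refine memℓp_gen ?_
  refine f.2.2.congr fun n => ?_
  rw [norm_mul, Complex.norm_real, Real.norm_of_nonneg (Real.sqrt_nonneg _), ENNReal.toReal_ofNat,
    Real.rpow_two, mul_pow, Real.sq_sqrt (weight_pos α n).le, mul_comm]

/-- The identification of `D_α` with `ℓ²`, by weighted Taylor coefficients. -/
noncomputable def toL2 (α : ℝ) : D α →ₗ[ℂ] L2 where
  toFun f := ⟨fun n => (√(weight α n) : ℂ) * taylorCoeff f n, memℓp_weighted f⟩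
  map_add' f g := lp.ext (funext fun n => by
    simp only [lp.coeFn_add, Pi.add_apply, Submodule.coe_add, taylorCoeff_add f.2.1 g.2.1, mul_add])
  map_smul' c f := lp.ext (funext fun n => by
    simp only [lp.coeFn_smul, Pi.smul_apply, Submodule.coe_smul, taylorCoeff_smul, smul_eq_mul,
      RingHom.id_apply]
    ring)

theorem toL2_apply (f : D α) (n : ℕ) : toL2 α f n = (√(weight α n) : ℂ) * taylorCoeff f n := rfl

theorem norm_toL2 (f : D α) : ‖toL2 α f‖ = normOf (usualInner α) f := by
  rw [normOf_usualInner, ← Real.sqrt_sq (norm_nonneg _), ← (hasSum_norm_sq _).tsum_eq]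
  congr 1
  refine tsum_congr fun n => ?_
  rw [toL2_apply, norm_mul, Complex.norm_real, Real.norm_of_nonneg (Real.sqrt_nonneg _), mul_pow,
    Real.sq_sqrt (weight_pos α n).le, mul_comm]

theorem toL2_injective (α : ℝ) : Function.Injective (toL2 α) := by
  rw [← LinearMap.ker_eq_bot, LinearMap.ker_eq_bot']
  intro f hf
  have h0 : ∀ n, taylorCoeff f n = 0 := fun n => by
    have h1 : toL2 α f n = 0 := by rw [hf]; rfl
    rw [toL2_apply, mul_eq_zero] at h1
    refine h1.resolve_left ?_
    exact Complex.ofReal_ne_zero.2 (Real.sqrt_pos.2 (weight_pos α n)).ne'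
  ext z
  have h := f.2.1.hasSum z
  simp only [h0, zero_mul] at h
  exact h.unique hasSum_zero

/-- Dividing by the square root of the weight costs at most a factor `n + 1`, so the resulting
series still converges in the disc. -/
theorem toL2_surjective (hα : -1 ≤ α) : Function.Surjective (toL2 α) := by
  intro x
  let c : ℕ → ℂ := fun n => (√(weight α n) : ℂ)⁻¹ * x n
  have hsq : ∀ n, 0 < √(weight α n) := fun n => Real.sqrt_pos.2 (weight_pos α n)
  have hc : ConvergesInDisc (PowerSeries.mk c) := by
    intro r hr hr1
    have h1 : Summable fun n : ℕ => ((n : ℝ) ^ 1 * r ^ n + r ^ n) * ‖x‖ := by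
      refine Summable.mul_right _ (Summable.add ?_ (summable_geometric_of_lt_one hr hr1))
      exact summable_pow_mul_geometric_of_norm_lt_one 1 (by rwa [Real.norm_of_nonneg hr])
    refine Summable.of_nonneg_of_le (fun n => by positivity) (fun n => ?_) h1
    have h2 : (√(weight α n))⁻¹ ≤ (n : ℝ) + 1 := by
      rw [inv_le_comm₀ (hsq n) (by positivity)]
      refine Real.le_sqrt_of_sq_le ?_
      have hn : (1 : ℝ) ≤ (n : ℝ) + 1 := by linarith [Nat.cast_nonneg (α := ℝ) n]
      have h3 : ((n : ℝ) + 1)⁻¹ ≤ weight α n := by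
        rw [← Real.rpow_neg_one]
        exact Real.rpow_le_rpow_of_exponent_le hn hα
      have h4 : ((n : ℝ) + 1)⁻¹ ≤ 1 := inv_le_one_of_one_le₀ hn
      have h5 : 0 ≤ ((n : ℝ) + 1)⁻¹ := by positivity
      nlinarith
    have h3 := lp.norm_apply_le_norm two_ne_zero x n
    rw [coeff_mk, norm_mul, norm_inv, Complex.norm_real, Real.norm_of_nonneg (hsq n).le]
    calc (√(weight α n))⁻¹ * ‖x n‖ * r ^ n ≤ ((n : ℝ) + 1) * ‖x‖ * r ^ n := by gcongr
      _ = _ := by ring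
  let f : 𝔻 → ℂ := fun z => evalSeries (PowerSeries.mk c) z
  have hf := isAnalytic_of_eq_evalSeries (f := f) hc fun z => rfl
  have hfc : ∀ n, taylorCoeff f n = c n := fun n => by
    rw [← coeff_taylorSeries, taylorSeries_of_eq_evalSeries (f := f) hc fun z => rfl, coeff_mk]
  have hmem : f ∈ D α := by
    refine ⟨hf, (hasSum_norm_sq x).summable.congr fun n => ?_⟩
    have h6 := (weight_pos α n).ne'
    rw [hfc, norm_mul, norm_inv, Complex.norm_real, Real.norm_of_nonneg (hsq n).le, mul_pow,
      inv_pow, Real.sq_sqrt (weight_pos α n).le]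
    field_simp
  refine ⟨⟨f, hmem⟩, lp.ext (funext fun n => ?_)⟩
  have h7 : (√(weight α n) : ℂ) ≠ 0 := Complex.ofReal_ne_zero.2 (hsq n).ne'
  rw [toL2_apply, hfc]
  simp only [c]
  rw [mul_inv_cancel_left₀ h7]

end Completeness

section Complete

/-- The inner product space defined by `c` is complete. -/
def CompleteFor {E : Type*} [AddCommGroup E] [Module ℂ E] (c : InnerProductSpace.Core ℂ E) : Prop :=
  letI : NormedAddCommGroup E := c.toNormedAddCommGroup
  CompleteSpace E

theorem completeFor_of_linearEquiv {E F : Type*} [AddCommGroup E] [Module ℂ E]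
    [NormedAddCommGroup F] [InnerProductSpace ℂ F] [CompleteSpace F]
    (c : InnerProductSpace.Core ℂ E) (e : E ≃ₗ[ℂ] F) {A B : ℝ}
    (hA : ∀ x, ‖e x‖ ≤ A * normOf c x) (hB : ∀ x, normOf c x ≤ B * ‖e x‖) : CompleteFor c := by
  let _ : NormedAddCommGroup E := c.toNormedAddCommGroup
  let _ : InnerProductSpace ℂ E := InnerProductSpace.ofCore c.toCore
  let e' := e.toContinuousLinearEquivOfBounds A B hA fun y => by
    have h := hB (e.symm y)
    rwa [e.apply_symm_apply] at h
  exact (completeSpace_congr (e := e'.toEquiv) e'.isUniformEmbedding).2 inferInstance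

/-- `D_α` is complete for every inner product whose norm is equivalent to the usual one. -/
theorem completeFor_of_equivalentNorms {α : ℝ} (hα : -1 ≤ α) (c : InnerProductSpace.Core ℂ (D α))
    (hc : EquivalentNorms (usualInner α) c) : CompleteFor c := by
  obtain ⟨A, B, hA, hB, h⟩ := hc
  have hbij : Function.Bijective (toL2 α) := ⟨toL2_injective α, toL2_surjective hα⟩
  refine completeFor_of_linearEquiv c (LinearEquiv.ofBijective (toL2 α) hbij)
    (A := A⁻¹) (B := B) (fun f => ?_) fun f => ?_
  · rw [LinearEquiv.ofBijective_apply, norm_toL2, inv_mul_eq_div, le_div_iff₀ hA, mul_comm]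
    exact (h f).1
  · rw [LinearEquiv.ofBijective_apply, norm_toL2]
    exact (h f).2

end Complete

end DirichletWandering

namespace DirichletWandering

/-! ### Transfer to inner products given as cores. -/

section Cores

variable {E : Type*} [AddCommGroup E] [Module ℂ E]

theorem hasWSPFor_of_shift (c : InnerProductSpace.Core ℂ E) (hcomp : CompleteFor c)
    {T : E →ₗ[ℂ] E} {V : E →ₗ[ℂ] (ℕ → ℂ)} {N : ℕ} {u : ℂ} {α t : ℝ}
    (hα : α ∈ Set.Icc (-1 : ℝ) 1) (ht : 0 < t)
    (hαt : α < 0 → ((N + t) / t) ^ (-α) ≤ 2) (hN : 1 ≤ N) (hu : ‖u‖ = 1)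
    (hnorm : ∀ f, HasSum (fun m : ℕ => ((m : ℝ) + t) ^ α * ‖V f m‖ ^ 2) (normOf c f ^ 2))
    (hshift : ∀ f m, V (T f) (m + N) = u * V f m) (hzero : ∀ f, ∀ m < N, V (T f) m = 0) :
    HasWSPFor c T := by
  let _ : NormedAddCommGroup E := c.toNormedAddCommGroup
  let _ : InnerProductSpace ℂ E := InnerProductSpace.ofCore c.toCore
  have : CompleteSpace E := hcomp
  exact hasWSP_of_shift hα ht hαt hN hu hnorm hshift hzero

/-- The inner product induced by an injective linear map to `ℓ²`. -/
@[reducible]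
noncomputable def pullbackCore (L : E →ₗ[ℂ] L2) (hL : Function.Injective L) :
    InnerProductSpace.Core ℂ E where
  inner f g := inner ℂ (L f) (L g)
  conj_inner_symm f g := inner_conj_symm _ _
  re_inner_nonneg f := inner_self_nonneg
  add_left f g h := by rw [map_add, inner_add_left]
  smul_left f g r := by rw [map_smul, inner_smul_left]
  definite f hf := hL (by rw [map_zero, inner_self_eq_zero.1 hf])

theorem normOf_pullbackCore (L : E →ₗ[ℂ] L2) (hL : Function.Injective L) (f : E) :
    normOf (pullbackCore L hL) f = ‖L f‖ :=
  (norm_eq_sqrt_re_inner (𝕜 := ℂ) (L f)).symm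

theorem equivalentNorms_of_sq_le {c d : InnerProductSpace.Core ℂ E} {A B : ℝ} (hA : 0 < A)
    (hB : 0 < B) (h1 : ∀ x, normOf c x ^ 2 ≤ A * normOf d x ^ 2)
    (h2 : ∀ x, normOf d x ^ 2 ≤ B * normOf c x ^ 2) : EquivalentNorms c d := by
  have hn : ∀ (e : InnerProductSpace.Core ℂ E) x, 0 ≤ normOf e x := fun e x => Real.sqrt_nonneg _
  refine ⟨(√A)⁻¹, √B, inv_pos.2 (Real.sqrt_pos.2 hA), Real.sqrt_pos.2 hB, fun x => ⟨?_, ?_⟩⟩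
  · rw [inv_mul_le_iff₀ (Real.sqrt_pos.2 hA)]
    refine abs_le_of_sq_le_sq' ?_ (mul_nonneg (Real.sqrt_nonneg _) (hn d x)) |>.2
    rw [mul_pow, Real.sq_sqrt hA.le]
    exact h1 x
  · refine abs_le_of_sq_le_sq' ?_ (mul_nonneg (Real.sqrt_nonneg _) (hn c x)) |>.2
    rw [mul_pow, Real.sq_sqrt hB.le]
    exact h2 x

end Cores

/-! ### Multiplication by `z ^ k` in the usual norm. -/

section Monomials

open PowerSeries

theorem summableAt_X_pow {r : ℝ} (hr : 0 ≤ r) (k : ℕ) : SummableAt r (X ^ k) := by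
  induction k with
  | zero => simpa using summableAt_C r 1
  | succ k ih => rw [pow_succ]; exact ih.mul hr (summableAt_X r)

theorem monomial_eq_evalSeries (k : ℕ) (z : 𝔻) : monomial k z = evalSeries (X ^ k) z := by
  rw [monomial, evalSeries, tsum_eq_single k fun n hn => by simp [coeff_X_pow, hn]]
  simp [coeff_X_pow]

/-- The Taylor coefficients as a linear map. -/
noncomputable def taylorCoeffs (α : ℝ) : D α →ₗ[ℂ] (ℕ → ℂ) where
  toFun f := taylorCoeff f
  map_add' f g := funext fun n => taylorCoeff_add f.2.1 g.2.1 n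
  map_smul' c f := funext fun n => taylorCoeff_smul c f n

theorem hasSum_normOf_usualInner {α : ℝ} (f : D α) :
    HasSum (fun n => weight α n * ‖taylorCoeff f n‖ ^ 2) (normOf (usualInner α) f ^ 2) := by
  rw [normOf_usualInner, Real.sq_sqrt (tsum_nonneg fun n =>
    mul_nonneg (sq_nonneg _) (weight_pos α n).le)]
  simpa only [mul_comm] using f.2.2.hasSum

/-- The operator of multiplication by `z ^ k` has the wandering subspace property for the usual
norm of `D_α` if `|α| log (k + 1) ≤ log 2`. -/
theorem exists_hasWSPFor_monomial {α : ℝ} {k : ℕ} (hk : 1 ≤ k)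
    (hα : |α| ≤ Real.log 2 / Real.log ((k : ℝ) + 1)) :
    ∃ hk : IsMultiplier α (monomial k), HasWSPFor (usualInner α) (mulOp hk) := by
  have hk1 : (1 : ℝ) ≤ k := by exact_mod_cast hk
  have hlog2 : 0 < Real.log 2 := Real.log_pos one_lt_two
  have hlogk : Real.log 2 ≤ Real.log ((k : ℝ) + 1) :=
    Real.log_le_log two_pos (by linarith)
  have hα1 : α ∈ Set.Icc (-1 : ℝ) 1 :=
    abs_le.1 (hα.trans ((div_le_one (hlog2.trans_le hlogk)).2 hlogk))
  have hX : ConvergesInDisc ((X : PowerSeries ℂ) ^ k) := fun r hr _ => summableAt_X_pow hr k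
  have ha := isAnalytic_of_eq_evalSeries hX (monomial_eq_evalSeries k)
  have hs := taylorSeries_of_eq_evalSeries hX (monomial_eq_evalSeries k)
  have hm : IsMultiplier α (monomial k) :=
    isMultiplier_of_summableAt hα1 one_lt_two ha (hs ▸ summableAt_X_pow zero_le_two k)
  have hcoeff : ∀ (f : D α) n, taylorCoeffs α (mulOp hm f) n = coeff n (X ^ k * taylorSeries f) :=
    fun f n => by
      rw [← hs, ← taylorSeries_mul ha f.2.1, coeff_taylorSeries]
      rfl
  refine ⟨hm, hasWSPFor_of_shift (usualInner α) (completeFor_of_equivalentNorms hα1.1 _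
    ⟨1, 1, one_pos, one_pos, fun x => by simp⟩) (V := taylorCoeffs α) (u := 1) (t := 1) (N := k)
    hα1 one_pos (fun h => ?_) hk norm_one hasSum_normOf_usualInner (fun f m => ?_)
    fun f m h => ?_⟩
  -- With `t = 1` the condition is `(k + 1) ^ (-α) ≤ 2`, the logarithmic bound on `|α|` in
  -- exponential form.
  · rw [div_one, Real.rpow_def_of_pos (by linarith)]
    rw [abs_of_neg h, le_div_iff₀ (hlog2.trans_le hlogk), mul_comm] at hα
    exact (Real.exp_le_exp.2 hα).trans_eq (Real.exp_log two_pos)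
  · rw [hcoeff, coeff_X_pow_mul, coeff_taylorSeries, one_mul]
    rfl
  · rw [hcoeff, coeff_X_pow_mul', if_neg (not_le.2 h)]

end Monomials

/-! ### Finite Blaschke products and the equivalent norm. -/

section Blaschke

open PowerSeries

variable {a : ℕ → ℂ} {q α : ℝ}

theorem pair_add_left {r : ℝ} {f₁ f₂ g : PowerSeries ℂ} (hf₁ : ConvergesInDisc f₁)
    (hf₂ : ConvergesInDisc f₂) (hr : 1 < r) (hg : SummableAt r g) :
    pair (f₁ + f₂) g = pair f₁ g + pair f₂ g := by
  rw [pair, pair, pair, ← (summable_pair hf₁ hr hg).tsum_add (summable_pair hf₂ hr hg)]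
  exact tsum_congr fun n => by rw [map_add, add_mul]

/-- The coefficients of a function with respect to the Takenaka–Malmquist system. -/
noncomputable def takenakaCoeffs (α : ℝ) (hq : 0 ≤ q) (hq1 : q < 1) (ha : ∀ m, ‖a m‖ ≤ q) :
    D α →ₗ[ℂ] (ℕ → ℂ) where
  toFun f m := pair (taylorSeries f) (takenaka a m)
  map_add' f g := funext fun m => by
    obtain ⟨r, hr, -, hra⟩ := exists_radius hq hq1 ha
    rw [Submodule.coe_add, taylorSeries_add f.2.1 g.2.1,
      pair_add_left f.2.1.convergesInDisc g.2.1.convergesInDisc hr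
        (summableAt_takenaka (by linarith) hra m)]
    rfl
  map_smul' c f := funext fun m => by
    rw [Submodule.coe_smul, taylorSeries_smul, pair_C_mul_left]
    rfl

/-- In `D_α` the weighted norms of the Taylor coefficients and of the Takenaka–Malmquist
coefficients are equivalent. -/
theorem exists_takenaka_bounds (hq : 0 ≤ q) (hq1 : q < 1) (ha : ∀ m, ‖a m‖ ≤ q)
    (hα : α ∈ Set.Icc (-1 : ℝ) 1) : ∃ C C' : ℝ, 0 < C ∧ 0 < C' ∧ ∀ f : D α,
      Summable (fun m => weight α m * ‖takenakaCoeffs α hq hq1 ha f m‖ ^ 2) ∧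
      ∑' m, weight α m * ‖takenakaCoeffs α hq hq1 ha f m‖ ^ 2
        ≤ C * normOf (usualInner α) f ^ 2 ∧
      normOf (usualInner α) f ^ 2
        ≤ C' * ∑' m, weight α m * ‖takenakaCoeffs α hq hq1 ha f m‖ ^ 2 := by
  obtain ⟨r, hr, -, hra⟩ := exists_radius hq hq1 ha
  obtain ⟨b, hb⟩ := exists_hilbertBasis_takenaka hq hq1 ha
  obtain ⟨K, A, s, hK, hA, hs, hs1, h1⟩ := exists_coeff_takenaka_le hq hq1 ha
  obtain ⟨K', A', s', hK', hA', hs', hs1', h2⟩ := exists_coeff_takenaka_le' hq hq1 ha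
  -- The entry is the conjugate of coefficient `m` of the function of index `n`, so the roles of the
  -- indices are exchanged and decay in the index of the function is what is needed.
  have hW : ∀ m n, ‖b.repr (lp.single 2 m 1) n‖ ≤ K' * A' ^ m * s' ^ n := fun m n => by
    rw [b.repr_apply_apply, lp.inner_single_right, hb, RCLike.inner_apply, one_mul,
      RCLike.norm_conj]
    exact h2 n m
  have hW' : ∀ m n, ‖b.repr.symm (lp.single 2 m 1) n‖ ≤ K * A ^ m * s ^ n := fun m n => by
    rw [b.repr_symm_single, hb]
    exact h1 m n
  obtain ⟨C, hC, hbound⟩ := exists_weightBounded (W := b.repr) hK' hA' hs' hs1' hW hK hA hs hs1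
    hW' hα
  obtain ⟨C', hC', hbound'⟩ := exists_weightBounded (W := b.repr.symm) hK hA hs hs1 hW' hK' hA'
    hs' hs1' (by simpa using hW) hα
  refine ⟨C, 2 * C', hC, by positivity, fun f => ?_⟩
  refine weighted_bounds hbound hbound' (hasSum_normOf_usualInner f) fun m => ?_
  have h3 := (summable_pair f.2.1.convergesInDisc hr
    (summableAt_takenaka (by linarith) hra m)).hasSum.tendsto_sum_nat
  refine h3.congr fun J => ?_
  rw [b.repr_apply_apply, truncate, inner_sum]
  refine Finset.sum_congr rfl fun n _ => ?_
  rw [lp.inner_single_right, hb, RCLike.inner_apply, coeff_taylorSeries]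

/-- From `m + 1 ≤ m + N ≤ N * (m + 1)`, replacing `(m + 1) ^ α` by `(m + N) ^ α` changes the norm
only to an equivalent one. -/
theorem rpow_add_le_mul_weight {N : ℕ} (hN : 1 ≤ N) (hα : α ∈ Set.Icc (-1 : ℝ) 1) (m : ℕ) :
    ((m : ℝ) + N) ^ α ≤ N * weight α m ∧ weight α m ≤ N * ((m : ℝ) + N) ^ α := by
  have hN1 : (1 : ℝ) ≤ N := by exact_mod_cast hN
  have hN0 : (0 : ℝ) < N := by linarith
  have hm : (0 : ℝ) < (m : ℝ) + 1 := by positivity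
  have hle : (m : ℝ) + 1 ≤ (m : ℝ) + N := by linarith
  have hge : (m : ℝ) + N ≤ N * ((m : ℝ) + 1) := by
    nlinarith [Nat.cast_nonneg (α := ℝ) m]
  have hpow : ∀ β : ℝ, 0 ≤ β → β ≤ 1 → ((m : ℝ) + N) ^ β ≤ N * ((m : ℝ) + 1) ^ β := by
    intro β h0 h1
    calc ((m : ℝ) + N) ^ β ≤ (N * ((m : ℝ) + 1)) ^ β :=
          Real.rpow_le_rpow (by positivity) hge h0
      _ = (N : ℝ) ^ β * ((m : ℝ) + 1) ^ β := Real.mul_rpow hN0.le hm.le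
      _ ≤ N * ((m : ℝ) + 1) ^ β := by
          gcongr
          exact (Real.rpow_le_rpow_of_exponent_le hN1 h1).trans_eq (Real.rpow_one _)
  rw [weight]
  rcases le_or_gt 0 α with h | h
  · have h1 : ((m : ℝ) + 1) ^ α ≤ ((m : ℝ) + N) ^ α := Real.rpow_le_rpow hm.le hle h
    exact ⟨hpow α h hα.2, h1.trans (le_mul_of_one_le_left (by positivity) hN1)⟩
  · have h1 : ((m : ℝ) + N) ^ α ≤ ((m : ℝ) + 1) ^ α :=
      Real.rpow_le_rpow_of_nonpos hm hle h.le
    refine ⟨h1.trans (le_mul_of_one_le_left (by positivity) hN1), ?_⟩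
    have h2 := hpow (-α) (by linarith) (by linarith [hα.1])
    rw [Real.rpow_neg (by positivity), Real.rpow_neg hm.le, ← div_eq_mul_inv,
      inv_le_comm₀ (by positivity) (by positivity), inv_div, div_le_iff₀ hN0] at h2
    linarith

/-- The Takenaka–Malmquist coefficients, weighted by `(m + N) ^ α`, define an equivalent inner
product on `D_α`. -/
theorem exists_takenakaCore (hq : 0 ≤ q) (hq1 : q < 1) (ha : ∀ m, ‖a m‖ ≤ q)
    (hα : α ∈ Set.Icc (-1 : ℝ) 1) {N : ℕ} (hN : 1 ≤ N) :
    ∃ c : InnerProductSpace.Core ℂ (D α), EquivalentNorms (usualInner α) c ∧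
      ∀ f, HasSum (fun m : ℕ => ((m : ℝ) + N) ^ α * ‖takenakaCoeffs α hq hq1 ha f m‖ ^ 2)
        (normOf c f ^ 2) := by
  obtain ⟨C, C', hC, hC', hV⟩ := exists_takenaka_bounds hq hq1 ha hα
  set V := takenakaCoeffs α hq hq1 ha with hVdef
  have hN0 : (0 : ℝ) < N := by exact_mod_cast hN
  let w : ℕ → ℝ := fun m => ((m : ℝ) + N) ^ α
  have hw : ∀ m, 0 ≤ w m := fun m => by positivity
  have hterm : ∀ f m, ‖(√(w m) : ℂ) * V f m‖ ^ 2 = w m * ‖V f m‖ ^ 2 := fun f m => by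
    rw [norm_mul, Complex.norm_real, Real.norm_of_nonneg (Real.sqrt_nonneg _), mul_pow,
      Real.sq_sqrt (hw m)]
  have hle : ∀ f m, w m * ‖V f m‖ ^ 2 ≤ N * (weight α m * ‖V f m‖ ^ 2) := fun f m => by
    rw [← mul_assoc]
    exact mul_le_mul_of_nonneg_right (rpow_add_le_mul_weight hN hα m).1 (sq_nonneg _)
  have hge : ∀ f m, weight α m * ‖V f m‖ ^ 2 ≤ N * (w m * ‖V f m‖ ^ 2) := fun f m => by
    rw [← mul_assoc]
    exact mul_le_mul_of_nonneg_right (rpow_add_le_mul_weight hN hα m).2 (sq_nonneg _)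
  have hsum : ∀ f, Summable fun m => w m * ‖V f m‖ ^ 2 := fun f =>
    Summable.of_nonneg_of_le (fun m => mul_nonneg (hw m) (sq_nonneg _)) (hle f)
      ((hV f).1.mul_left _)
  have hmem : ∀ f, Memℓp (fun m => (√(w m) : ℂ) * V f m) 2 := fun f => by
    refine memℓp_gen ((hsum f).congr fun m => ?_)
    rw [ENNReal.toReal_ofNat, Real.rpow_two, hterm]
  let L : D α →ₗ[ℂ] L2 :=
    { toFun := fun f => ⟨fun m => (√(w m) : ℂ) * V f m, hmem f⟩
      map_add' := fun f g => lp.ext (funext fun m => by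
        simp only [map_add, Pi.add_apply, lp.coeFn_add, mul_add])
      map_smul' := fun c f => lp.ext (funext fun m => by
        simp only [map_smul, Pi.smul_apply, lp.coeFn_smul, smul_eq_mul, RingHom.id_apply]
        ring) }
  have hnorm : ∀ f, HasSum (fun m => w m * ‖V f m‖ ^ 2) (‖L f‖ ^ 2) := fun f =>
    (hasSum_norm_sq (L f)).congr_fun fun m => (hterm f m).symm
  have hup : ∀ f, ‖L f‖ ^ 2 ≤ N * C * normOf (usualInner α) f ^ 2 := fun f => by
    have h1 := hasSum_le (hle f) (hnorm f) ((hV f).1.hasSum.mul_left _)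
    have h2 := mul_le_mul_of_nonneg_left (hV f).2.1 hN0.le
    linarith
  have hlow : ∀ f, normOf (usualInner α) f ^ 2 ≤ C' * N * ‖L f‖ ^ 2 := fun f => by
    have h1 := hasSum_le (hge f) (hV f).1.hasSum ((hnorm f).mul_left _)
    have h2 := mul_le_mul_of_nonneg_left h1 hC'.le
    linarith [(hV f).2.2]
  have hinj : Function.Injective L := by
    rw [← LinearMap.ker_eq_bot, LinearMap.ker_eq_bot']
    intro f hf
    have h1 := hlow f
    rw [hf, norm_zero, ← norm_toL2] at h1
    have h2 : ‖toL2 α f‖ = 0 := by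
      refine pow_eq_zero_iff two_ne_zero |>.1 (le_antisymm ?_ (sq_nonneg _))
      simpa using h1
    exact toL2_injective α (by rw [norm_eq_zero.1 h2, map_zero])
  refine ⟨pullbackCore L hinj, equivalentNorms_of_sq_le (mul_pos hC' hN0) (mul_pos hN0 hC)
    (fun f => ?_) (fun f => ?_), fun f => ?_⟩
  · rw [normOf_pullbackCore]; exact hlow f
  · rw [normOf_pullbackCore]; exact hup f
  · rw [normOf_pullbackCore]; exact hnorm f

/-- Periodicity of the zeros makes multiplication by the product over one period act as a shift by
`N` on the system. -/
theorem takenaka_add {N : ℕ} (hper : ∀ m, a (N + m) = a m) (m : ℕ) :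
    takenaka a (m + N) = partialProd a N * takenaka a m := by
  have h : partialProd a (m + N) = partialProd a N * partialProd a m := by
    rw [add_comm, partialProd, Finset.prod_range_add]
    simp only [hper]
    rfl
  rw [takenaka, takenaka, h, add_comm m N, hper]
  ring

/-- Multiplication by a finite Blaschke product on `D_α`, `|α| ≤ 1`, has the wandering subspace
property for an equivalent norm. -/
theorem exists_hasWSPFor_blaschke (hα : α ∈ Set.Icc (-1 : ℝ) 1) {N : ℕ} (θ : ℝ) (z : Fin N → 𝔻)
    (hN : 1 ≤ N) :
    ∃ hB : IsMultiplier α (blaschke θ z), ∃ c : InnerProductSpace.Core ℂ (D α),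
      EquivalentNorms (usualInner α) c ∧ HasWSPFor c (mulOp hB) := by
  -- The zeros are repeated with period `N`, so that `partialProd a N` is the Blaschke product up to
  -- a unimodular constant.
  let a : ℕ → ℂ := fun m => z ⟨m % N, Nat.mod_lt m hN⟩
  have hper : ∀ m, a (N + m) = a m := fun m => by simp [a]
  obtain ⟨q, hq, hq1, ha⟩ : ∃ q : ℝ, 0 ≤ q ∧ q < 1 ∧ ∀ m, ‖a m‖ ≤ q := by
    obtain ⟨i, -, hi⟩ := Finset.exists_max_image Finset.univ (fun i => ‖(z i : ℂ)‖)
      ⟨⟨0, hN⟩, Finset.mem_univ _⟩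
    exact ⟨_, norm_nonneg _, (z i).norm_lt_one, fun m => hi _ (Finset.mem_univ _)⟩
  have ha1 : ∀ m, ‖a m‖ < 1 := fun m => (ha m).trans_lt hq1
  obtain ⟨r, hr, -, hra⟩ := exists_radius hq hq1 ha
  have hr0 : 0 ≤ r := by linarith
  let u := Complex.exp (θ * Complex.I)
  have hu1 : ‖u‖ = 1 := Complex.norm_exp_ofReal_mul_I θ
  have hP : SummableAt r (C u * partialProd a N) :=
    (summableAt_C r u).mul hr0 (summableAt_partialProd hr0 hra N)
  have hPc : ConvergesInDisc (partialProd a N) := convergesInDisc_prod ha1 (Finset.range N)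
  have heval : ∀ w : 𝔻, blaschke θ z w = evalSeries (C u * partialProd a N) w := by
    intro w
    rw [evalSeries_mul (convergesInDisc_C u) hPc w.norm_lt_one, evalSeries_C,
      evalSeries_prod_factor ha1 w.norm_lt_one, Finset.prod_range, blaschke]
    simp [a, u, Nat.mod_eq_of_lt]
  have hB := isAnalytic_of_eq_evalSeries (hP.convergesInDisc hr.le) heval
  have hs := taylorSeries_of_eq_evalSeries (hP.convergesInDisc hr.le) heval
  have hm : IsMultiplier α (blaschke θ z) := isMultiplier_of_summableAt hα hr hB (hs ▸ hP)
  obtain ⟨c, hc, hnorm⟩ := exists_takenakaCore hq hq1 ha hα hN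
  have hV : ∀ (f : D α) m, takenakaCoeffs α hq hq1 ha (mulOp hm f) m
      = u * pair (partialProd a N * taylorSeries f) (takenaka a m) := fun f m => by
    rw [← pair_C_mul_left, ← mul_assoc, ← hs, ← taylorSeries_mul hB f.2.1]
    rfl
  have hN0 : (0 : ℝ) < N := by exact_mod_cast hN
  refine ⟨hm, c, hc, hasWSPFor_of_shift c (completeFor_of_equivalentNorms hα.1 c hc)
    (V := takenakaCoeffs α hq hq1 ha) (t := N) hα hN0 (fun h => ?_) hN hu1 hnorm (fun f m => ?_)
    fun f m h => ?_⟩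
  -- The choice `t = N` turns the ratio into `2`, and `2 ^ (-α) ≤ 2` because `α ≥ -1`.
  · rw [← two_mul, mul_div_cancel_right₀ _ hN0.ne']
    exact (Real.rpow_le_rpow_of_exponent_le one_le_two (by linarith [hα.1])).trans_eq
      (Real.rpow_one _)
  · rw [hV, takenaka_add hper, pair_partialProd_mul f.2.1.convergesInDisc hr
      (summableAt_takenaka hr0 hra m) ha1 hra]
    rfl
  · rw [hV, pair_partialProd_mul_takenaka hq hq1 ha f.2.1.convergesInDisc h, mul_zero]

end Blaschke

end DirichletWandering
theorem mainTheorem1 :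
    (∀ α : ℝ, α ∈ Set.Icc (-1 : ℝ) 1 →
      ∀ (N : ℕ) (θ : ℝ) (a : Fin N → Complex.UnitDisc), 1 ≤ N →
        ∃ hB : DirichletWandering.IsMultiplier α (DirichletWandering.blaschke θ a),
          ∃ c : InnerProductSpace.Core ℂ (DirichletWandering.D α),
            DirichletWandering.EquivalentNorms (DirichletWandering.usualInner α) c ∧
            DirichletWandering.HasWSPFor c (DirichletWandering.mulOp hB)) ∧
    (∀ (α : ℝ) (k : ℕ), 1 ≤ k → |α| ≤ Real.log 2 / Real.log ((k : ℝ) + 1) →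
      ∃ hk : DirichletWandering.IsMultiplier α (DirichletWandering.monomial k),
        DirichletWandering.HasWSPFor (DirichletWandering.usualInner α)
          (DirichletWandering.mulOp hk)) :=
  ⟨fun _ hα _ θ a hN => DirichletWandering.exists_hasWSPFor_blaschke hα θ a hN,
    fun _ _ hk hα => DirichletWandering.exists_hasWSPFor_monomial hk hα⟩
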